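/- **Proposition 2.1 (generation and interpolation).** Let $L>0$ and let $\mu,\kappa\in\mathbb{R}$ with $\mu\kappa>0$. Let $\mathcal{H}=L^2(0,L)\times\mathbb{R}$ (real-valued functions) be the Hilbert space with inner product $$\langle (y,\alpha),(\varphi,\beta)\rangle_{\mathcal{H}}=\int_0^L y\varphi\,dx+\frac{\mu}{\kappa}\,\alpha\beta .$$ For $s\in\{1,2\}$ let $\mathcal{H}^s=\{(y,\alpha)\in H^s(0,L)\times\mathbb{R} : y(0)=\mu\alpha\}$, where $\mathcal{H}^1$ carries the norm $\|(y,\alpha)\|_{\mathcal{H}^1}^2=\int_0^L |y|^2dx+\int_0^L|y'|^2dx+\frac{\mu}{\kappa}\alpha^2$. Let $\mathcal{A}$ be the operator on $\mathcal{H}$ with domain $$D(\mathcal{A})=\{(y,\alpha)\in\mathcal{H}^2 : y'(L)=0\},\qquad \mathcal{A}(y,\alpha)=(y'',\,\kappa\, y'(0)).$$ Then: 1. $\mathcal{A}$ is densely defined and self-adjoint on $\mathcal{H}$. 2. $\mathcal{A}$ generates an analytic $C_0$-semigroup $(e^{t\mathcal{A}})_{t\ge0}$ on $\mathcal{H}$;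 that is, $\mathcal{A}$ is the generator of a $C_0$-semigroup on $\mathcal{H}$ whose extension to the complexification of $\mathcal{H}$ extends to an analytic semigroup on a sector $\{z\ne0:|\arg z|<\delta\}$ for some $\delta\in(0,\pi/2]$. 3. With $D(\mathcal{A})$ equipped with the graph norm $\|U\|_{\mathcal{H}}+\|\mathcal{A}U\|_{\mathcal{H}}$, the real interpolation space $[\mathcal{H},D(\mathcal{A})]_{1/2,2}$ (defined by the $K$-functional) equals $\mathcal{H}^1$, with equivalent norms. -/

import Mathlib

open Set Filter Topology MeasureTheory
open scoped ENNReal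

noncomputable section

namespace HeatODE

/-! ## Abstract notions: semigroups, analytic semigroups, real interpolation -/

section Complexification

/-- The complexification `E ⊕ iE` of a real inner product space, with `‖x + iy‖² = ‖x‖² + ‖y‖²`. -/
def Complexification (E : Type*) : Type _ := WithLp 2 (E × E)

namespace Complexification

set_option linter.unusedSectionVars false

variable {E : Type*} [NormedAddCommGroup E] [InnerProductSpace ℝ E]

instance : NormedAddCommGroup (Complexification E) :=
  inferInstanceAs (NormedAddCommGroup (WithLp 2 (E × E)))

/-- The element `x + iy`. -/
def mk (x y : E) : Complexification E := WithLp.toLp 2 (x, y)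

/-- The real part of an element of the complexification. -/
def fst (u : Complexification E) : E := WithLp.fst u

/-- The imaginary part of an element of the complexification. -/
def snd (u : Complexification E) : E := WithLp.snd u

@[simp] lemma fst_mk (x y : E) : (mk x y).fst = x := rfl
@[simp] lemma snd_mk (x y : E) : (mk x y).snd = y := rfl
@[simp] lemma fst_add (u v : Complexification E) : (u + v).fst = u.fst + v.fst := rfl
@[simp] lemma snd_add (u v : Complexification E) : (u + v).snd = u.snd + v.snd := rfl
@[simp] lemma fst_zero : (0 : Complexification E).fst = 0 := rfl
@[simp] lemma snd_zero : (0 : Complexification E).snd = 0 := rfl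

@[ext] lemma ext {u v : Complexification E} (h₁ : u.fst = v.fst) (h₂ : u.snd = v.snd) : u = v :=
  WithLp.ofLp_injective 2 (Prod.ext h₁ h₂)

lemma norm_sq_eq (u : Complexification E) : ‖u‖ ^ 2 = ‖u.fst‖ ^ 2 + ‖u.snd‖ ^ 2 :=
  WithLp.prod_norm_sq_eq_of_L2 (α := E) (β := E) u

/-- `(a + ib)(x + iy) = (ax - by) + i(ay + bx)`. -/
instance : SMul ℂ (Complexification E) :=
  ⟨fun z u => mk (z.re • u.fst - z.im • u.snd) (z.re • u.snd + z.im • u.fst)⟩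

@[simp] lemma fst_smul (z : ℂ) (u : Complexification E) :
    (z • u).fst = z.re • u.fst - z.im • u.snd := rfl
@[simp] lemma snd_smul (z : ℂ) (u : Complexification E) :
    (z • u).snd = z.re • u.snd + z.im • u.fst := rfl

instance : Module ℂ (Complexification E) where
  one_smul u := by ext <;> simp
  mul_smul z w u := by ext <;> simp <;> module
  smul_zero z := by ext <;> simp
  smul_add z u v := by ext <;> simp <;> module
  add_smul z w u := by ext <;> simp <;> module
  zero_smul u := by ext <;> simp

instance : NormedSpace ℂ (Complexification E) where
  norm_smul_le z u := by
    refine le_of_eq ?_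
    rw [← sq_eq_sq₀ (norm_nonneg _) (by positivity), mul_pow, norm_sq_eq, norm_sq_eq,
      fst_smul, snd_smul, @norm_sub_sq_real, @norm_add_sq_real, Complex.sq_norm,
      Complex.normSq_apply]
    simp only [norm_smul, inner_smul_left, inner_smul_right, mul_pow, Real.norm_eq_abs, sq_abs,
      real_inner_comm u.snd u.fst, RCLike.conj_to_real]
    ring

end Complexification

end Complexification

section Semigroups

variable {X : Type*} [NormedAddCommGroup X]

/-- `(T t)_{t ≥ 0}` is a `C₀`-semigroup of bounded operators (only `t ≥ 0` matters). -/
structure IsC0Semigroup [NormedSpace ℝ X] (T : ℝ → X →L[ℝ] X) : Prop where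
  map_zero : T 0 = ContinuousLinearMap.id ℝ X
  map_add : ∀ s t : ℝ, 0 ≤ s → 0 ≤ t → T (s + t) = (T s).comp (T t)
  continuousOn : ∀ x : X, ContinuousOn (fun t => T t x) (Ici 0)

/-- `A` is the infinitesimal generator of `(T t)_{t ≥ 0}`: `x ∈ D(A)` with `A x = y` exactly when
`(T t x - x) / t → y` as `t ↓ 0`. -/
def IsGenerator [NormedSpace ℝ X] (A : X →ₗ.[ℝ] X) (T : ℝ → X →L[ℝ] X) : Prop :=
  ∀ x y : X, (x, y) ∈ A.graph ↔ Tendsto (fun t : ℝ => t⁻¹ • (T t x - x)) (𝓝[>] 0) (𝓝 y)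

/-- The open sector `{z ≠ 0 : |arg z| < δ}`. -/
def sector (δ : ℝ) : Set ℂ := {z | z ≠ 0 ∧ |z.arg| < δ}

/-- `(S z)`, `z ∈ sector δ ∪ {0}`, is an analytic semigroup of angle `δ` on the complex space `X`. -/
structure IsAnalyticSemigroup [NormedSpace ℂ X] (δ : ℝ) (S : ℂ → X →L[ℂ] X) : Prop where
  map_zero : S 0 = ContinuousLinearMap.id ℂ X
  map_add : ∀ z ∈ sector δ, ∀ w ∈ sector δ, S (z + w) = (S z).comp (S w)
  differentiableOn : DifferentiableOn ℂ S (sector δ)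
  tendsto : ∀ δ' : ℝ, 0 < δ' → δ' < δ → ∀ x : X,
    Tendsto (fun z => S z x) (𝓝[sector δ'] 0) (𝓝 x)

/-- The operator `A` on the real space `X` generates an analytic `C₀`-semigroup: `A` is the
generator of a `C₀`-semigroup `(T t)_{t ≥ 0}` on `X` whose complexification
`x + iy ↦ T t x + i T t y` extends to an analytic semigroup on a sector of some angle
`δ ∈ (0, π/2]`. -/
def GeneratesAnalyticC0Semigroup [InnerProductSpace ℝ X] (A : X →ₗ.[ℝ] X) : Prop :=
  ∃ T : ℝ → X →L[ℝ] X, IsC0Semigroup T ∧ IsGenerator A T ∧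
    ∃ δ : ℝ, 0 < δ ∧ δ ≤ Real.pi / 2 ∧
      ∃ S : ℂ → Complexification X →L[ℂ] Complexification X, IsAnalyticSemigroup δ S ∧
        ∀ t : ℝ, 0 ≤ t → ∀ x y : X,
          S t (Complexification.mk x y) = Complexification.mk (T t x) (T t y)

end Semigroups

section Interpolation

variable {X : Type*} [NormedAddCommGroup X] [NormedSpace ℝ X]

/-- The graph norm `‖x‖ + ‖A x‖` on `D(A)`. -/
def graphNorm (A : X →ₗ.[ℝ] X) (x : A.domain) : ℝ := ‖(x : X)‖ + ‖A x‖

/-- Peetre's functional `K(t, x) = inf {‖a‖_X + t ‖b‖_Y : x = a + b, a ∈ X, b ∈ Y}`, for a subspace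
`Y` of `X` with norm `N`. -/
def kFunctional (Y : Submodule ℝ X) (N : Y → ℝ) (t : ℝ) (x : X) : ℝ≥0∞ :=
  ⨅ b : Y, ENNReal.ofReal (‖x - b‖ + t * N b)

/-- The norm of the real interpolation space `[X, Y]_{θ,p}`, `1 ≤ p < ∞`, given by
`(∫₀^∞ (t^{-θ} K(t, x))^p dt/t)^{1/p}`; the value is `∞` off the space. -/
def interpNorm (Y : Submodule ℝ X) (N : Y → ℝ) (θ p : ℝ) (x : X) : ℝ≥0∞ :=
  (∫⁻ t in Ioi (0 : ℝ),
    (ENNReal.ofReal (t ^ (-θ)) * kFunctional Y N t x) ^ p * ENNReal.ofReal t⁻¹) ^ (1 / p)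

/-- The real interpolation space `[X, Y]_{θ,p}`. -/
def interpSpace (Y : Submodule ℝ X) (N : Y → ℝ) (θ p : ℝ) : Set X :=
  {x | interpNorm Y N θ p x < ⊤}

end Interpolation

/-! ## Weak derivatives and boundary values on `(0, L)` -/

/-- The real Hilbert space `L²(0, L)`. -/
abbrev L2 (L : ℝ) : Type := Lp ℝ 2 (volume.restrict (Ioo 0 L))

section Sobolev

variable {L : ℝ}

/-- `g ∈ L²(0, L)` is the distributional derivative of `y`. -/
def IsWeakDeriv (y g : L2 L) : Prop :=
  ∀ φ : ℝ → ℝ, ContDiff ℝ (⊤ : ℕ∞) φ → HasCompactSupport φ → tsupport φ ⊆ Ioo 0 L →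
    ∫ x in Ioo 0 L, y x * deriv φ x = - ∫ x in Ioo 0 L, g x * φ x

/-- `y` has a representative continuous on `[0, L]`, whose value at `a` is `c`. -/
def HasBoundaryValue (y : L2 L) (a c : ℝ) : Prop :=
  ∃ u : ℝ → ℝ, ContinuousOn u (Icc 0 L) ∧ u =ᵐ[volume.restrict (Ioo 0 L)] y ∧ u a = c

open Classical in
/-- The distributional derivative of `y` (zero if `y ∉ H¹(0, L)`). -/
def weakDeriv (y : L2 L) : L2 L :=
  if h : ∃ g, IsWeakDeriv y g then h.choose else 0

open Classical in
/-- The value at `a` of the continuous representative of `y` (zero if there is none). -/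
def boundaryValue (y : L2 L) (a : ℝ) : ℝ :=
  if h : ∃ c, HasBoundaryValue y a c then h.choose else 0

lemma integrable_mul (y : L2 L) {ψ : ℝ → ℝ} (h₁ : Continuous ψ) (h₂ : HasCompactSupport ψ) :
    Integrable (fun x => y x * ψ x) (volume.restrict (Ioo 0 L)) := by
  have hy : Integrable (fun x => y x) (volume.restrict (Ioo 0 L)) :=
    (Lp.memLp y).integrable (by norm_num)
  obtain ⟨C, hC⟩ := h₁.bounded_above_of_compact_support h₂
  exact hy.mul_bdd h₁.aestronglyMeasurable (Eventually.of_forall hC)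

lemma IsWeakDeriv.add {y z g h : L2 L} (hy : IsWeakDeriv y g) (hz : IsWeakDeriv z h) :
    IsWeakDeriv (y + z) (g + h) := by
  intro φ h1 h2 h3
  have e1 : ∫ x in Ioo 0 L, (y + z : L2 L) x * deriv φ x
      = ∫ x in Ioo 0 L, (y x * deriv φ x + z x * deriv φ x) := by
    refine integral_congr_ae ?_
    filter_upwards [Lp.coeFn_add y z] with x hx
    rw [hx, Pi.add_apply, add_mul]
  have e2 : ∫ x in Ioo 0 L, (g + h : L2 L) x * φ x
      = ∫ x in Ioo 0 L, (g x * φ x + h x * φ x) := by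
    refine integral_congr_ae ?_
    filter_upwards [Lp.coeFn_add g h] with x hx
    rw [hx, Pi.add_apply, add_mul]
  have hd := h1.continuous_deriv (by simp)
  rw [e1, e2, integral_add (integrable_mul y hd h2.deriv) (integrable_mul z hd h2.deriv),
    integral_add (integrable_mul g h1.continuous h2) (integrable_mul h h1.continuous h2),
    hy φ h1 h2 h3, hz φ h1 h2 h3]
  ring

lemma IsWeakDeriv.smul {y g : L2 L} (c : ℝ) (hy : IsWeakDeriv y g) :
    IsWeakDeriv (c • y) (c • g) := by
  intro φ h1 h2 h3
  have e1 : ∫ x in Ioo 0 L, (c • y : L2 L) x * deriv φ x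
      = ∫ x in Ioo 0 L, c * (y x * deriv φ x) := by
    refine integral_congr_ae ?_
    filter_upwards [Lp.coeFn_smul c y] with x hx
    rw [hx, Pi.smul_apply, smul_eq_mul, mul_assoc]
  have e2 : ∫ x in Ioo 0 L, (c • g : L2 L) x * φ x = ∫ x in Ioo 0 L, c * (g x * φ x) := by
    refine integral_congr_ae ?_
    filter_upwards [Lp.coeFn_smul c g] with x hx
    rw [hx, Pi.smul_apply, smul_eq_mul, mul_assoc]
  rw [e1, e2, integral_const_mul, integral_const_mul, hy φ h1 h2 h3]
  ring

lemma IsWeakDeriv.zero : IsWeakDeriv (0 : L2 L) 0 := by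
  intro φ _ _ _
  have e : ∀ ψ : ℝ → ℝ, ∫ x in Ioo 0 L, (0 : L2 L) x * ψ x = 0 := by
    intro ψ
    refine integral_eq_zero_of_ae ?_
    filter_upwards [Lp.coeFn_zero ℝ 2 (volume.restrict (Ioo 0 L))] with x hx
    simp only [hx, Pi.zero_apply, zero_mul]
  rw [e, e, neg_zero]

/-- Weak derivatives are unique. -/
lemma IsWeakDeriv.unique {y g h : L2 L} (hg : IsWeakDeriv y g) (hh : IsWeakDeriv y h) :
    g = h := by
  have key : IsWeakDeriv (0 : L2 L) (g - h) := by
    have := hg.add (hh.smul (-1))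
    simpa [sub_eq_add_neg] using this
  rw [← sub_eq_zero]
  have hint : Integrable (fun x => (g - h : L2 L) x) (volume.restrict (Ioo 0 L)) :=
    (Lp.memLp (g - h)).integrable (by norm_num)
  have hae := isOpen_Ioo.ae_eq_zero_of_integral_contDiff_smul_eq_zero (U := Ioo 0 L)
    (f := fun x => (g - h : L2 L) x) (μ := volume)
    (IntegrableOn.locallyIntegrableOn hint) (by
      intro φ h1 h2 h3
      have k := key φ h1 h2 h3
      have e : ∫ x in Ioo 0 L, (0 : L2 L) x * deriv φ x = 0 := by
        refine integral_eq_zero_of_ae ?_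
        filter_upwards [Lp.coeFn_zero ℝ 2 (volume.restrict (Ioo 0 L))] with x hx
        simp only [hx, Pi.zero_apply, zero_mul]
      rw [e, zero_eq_neg] at k
      refine Eq.trans ?_ k
      refine Eq.trans ?_ (integral_indicator measurableSet_Ioo)
      refine integral_congr_ae (Eventually.of_forall fun x => ?_)
      by_cases hx : x ∈ Ioo 0 L
      · simp [hx, mul_comm]
      · have : φ x = 0 := by
          by_contra hne
          exact hx (h3 (subset_tsupport _ hne))
        simp [hx, this])
  rw [Lp.eq_zero_iff_ae_eq_zero]
  exact (ae_restrict_iff' measurableSet_Ioo).2 hae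

lemma IsWeakDeriv.weakDeriv_eq {y g : L2 L} (h : IsWeakDeriv y g) : weakDeriv y = g := by
  have hex : ∃ g, IsWeakDeriv y g := ⟨g, h⟩
  rw [weakDeriv, dif_pos hex]
  exact hex.choose_spec.unique h

lemma HasBoundaryValue.add {y z : L2 L} {a c d : ℝ} (hy : HasBoundaryValue y a c)
    (hz : HasBoundaryValue z a d) : HasBoundaryValue (y + z) a (c + d) := by
  obtain ⟨u, hu, hu', rfl⟩ := hy
  obtain ⟨w, hw, hw', rfl⟩ := hz
  exact ⟨u + w, hu.add hw, (hu'.add hw').trans (Lp.coeFn_add y z).symm, rfl⟩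

lemma HasBoundaryValue.smul {y : L2 L} {a c : ℝ} (r : ℝ) (hy : HasBoundaryValue y a c) :
    HasBoundaryValue (r • y) a (r * c) := by
  obtain ⟨u, hu, hu', rfl⟩ := hy
  exact ⟨r • u, hu.const_smul r, (hu'.const_smul r).trans (Lp.coeFn_smul r y).symm, rfl⟩

lemma HasBoundaryValue.zero (a : ℝ) : HasBoundaryValue (0 : L2 L) a 0 :=
  ⟨0, continuousOn_const, (Lp.coeFn_zero ℝ 2 _).symm, rfl⟩

/-- Boundary values are unique. -/
lemma HasBoundaryValue.unique (hL : 0 < L) {y : L2 L} {a c d : ℝ} (ha : a ∈ Icc 0 L)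
    (hc : HasBoundaryValue y a c) (hd : HasBoundaryValue y a d) : c = d := by
  obtain ⟨u, hu, hu', rfl⟩ := hc
  obtain ⟨w, hw, hw', rfl⟩ := hd
  have h : u =ᵐ[volume.restrict (Icc 0 L)] w := by
    rw [← restrict_Ioo_eq_restrict_Icc]
    exact hu'.trans hw'.symm
  exact Measure.eqOn_Icc_of_ae_eq volume hL.ne h hu hw ha

lemma HasBoundaryValue.boundaryValue_eq (hL : 0 < L) {y : L2 L} {a c : ℝ} (ha : a ∈ Icc 0 L)
    (h : HasBoundaryValue y a c) : boundaryValue y a = c := by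
  have hex : ∃ c, HasBoundaryValue y a c := ⟨c, h⟩
  rw [boundaryValue, dif_pos hex]
  exact hex.choose_spec.unique hL ha h

/-- The Sobolev space `H¹(0, L)`. -/
def H1 (L : ℝ) : Submodule ℝ (L2 L) where
  carrier := {y | ∃ g, IsWeakDeriv y g}
  add_mem' := fun ⟨g, hg⟩ ⟨h, hh⟩ => ⟨g + h, hg.add hh⟩
  zero_mem' := ⟨0, .zero⟩
  smul_mem' := fun c _ ⟨g, hg⟩ => ⟨c • g, hg.smul c⟩

lemma isWeakDeriv_weakDeriv {y : L2 L} (h : y ∈ H1 L) : IsWeakDeriv y (weakDeriv y) := by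
  obtain ⟨g, hg⟩ := h
  rwa [hg.weakDeriv_eq]

lemma weakDeriv_add {y z : L2 L} (hy : y ∈ H1 L) (hz : z ∈ H1 L) :
    weakDeriv (y + z) = weakDeriv y + weakDeriv z :=
  ((isWeakDeriv_weakDeriv hy).add (isWeakDeriv_weakDeriv hz)).weakDeriv_eq

lemma weakDeriv_smul {y : L2 L} (c : ℝ) (hy : y ∈ H1 L) :
    weakDeriv (c • y) = c • weakDeriv y :=
  ((isWeakDeriv_weakDeriv hy).smul c).weakDeriv_eq

lemma weakDeriv_zero : weakDeriv (0 : L2 L) = 0 := IsWeakDeriv.zero.weakDeriv_eq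

/-- The Sobolev space `H²(0, L)`. -/
def H2 (L : ℝ) : Submodule ℝ (L2 L) where
  carrier := {y | y ∈ H1 L ∧ weakDeriv y ∈ H1 L}
  add_mem' := fun ⟨hy, hy'⟩ ⟨hz, hz'⟩ =>
    ⟨add_mem hy hz, by rw [weakDeriv_add hy hz]; exact add_mem hy' hz'⟩
  zero_mem' := ⟨zero_mem _, by rw [weakDeriv_zero]; exact zero_mem _⟩
  smul_mem' := fun c _ ⟨hy, hy'⟩ =>
    ⟨(H1 L).smul_mem c hy, by rw [weakDeriv_smul c hy]; exact (H1 L).smul_mem c hy'⟩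

end Sobolev

/-! ## The state space `ℋ = L²(0, L) × ℝ` -/

section StateSpace

/-- The real line, to be equipped with the inner product `(μ/κ) α β`. -/
def WeightedLine (_μ _κ : ℝ) : Type := ℝ

namespace WeightedLine

variable {μ κ : ℝ}

instance : AddCommGroup (WeightedLine μ κ) := inferInstanceAs (AddCommGroup ℝ)
instance : Module ℝ (WeightedLine μ κ) := inferInstanceAs (Module ℝ ℝ)

/-- The underlying real number. -/
def toReal : WeightedLine μ κ ≃ₗ[ℝ] ℝ := LinearEquiv.refl ℝ ℝ

lemma div_pos_of_mul_pos (h : 0 < μ * κ) : 0 < μ / κ :=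
  div_pos_iff.2 (mul_pos_iff.1 h)

/-- The inner product `(μ/κ) α β`. -/
@[reducible] def core (h : 0 < μ * κ) : InnerProductSpace.Core ℝ (WeightedLine μ κ) where
  inner a b := μ / κ * (toReal a * toReal b)
  conj_inner_symm a b := by simp [mul_comm (toReal a)]
  re_inner_nonneg a := by
    have : 0 < μ / κ := div_pos_of_mul_pos h
    simpa using mul_nonneg this.le (mul_self_nonneg (toReal a))
  add_left a b c := by simp; ring
  smul_left a b r := by simp; ring
  definite a ha := by
    have h' : 0 < μ / κ := div_pos_of_mul_pos h
    simpa [h'.ne'] using ha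

variable [h : Fact (0 < μ * κ)]

instance : NormedAddCommGroup (WeightedLine μ κ) := (core h.out).toNormedAddCommGroup
instance : InnerProductSpace ℝ (WeightedLine μ κ) := InnerProductSpace.ofCore (core h.out).toCore

lemma inner_def (a b : WeightedLine μ κ) : inner ℝ a b = μ / κ * (toReal a * toReal b) := rfl

instance : FiniteDimensional ℝ (WeightedLine μ κ) := LinearEquiv.finiteDimensional toReal.symm
instance : CompleteSpace (WeightedLine μ κ) := FiniteDimensional.complete ℝ _

end WeightedLine

/-- The state space `ℋ = L²(0, L) × ℝ`, as the Hilbert sum of `L²(0, L)` and the weighted line. -/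
abbrev StateSpace (L μ κ : ℝ) : Type := WithLp 2 (L2 L × WeightedLine μ κ)

namespace StateSpace

variable {L μ κ : ℝ}

/-- The couple `(y, α)`. -/
def mk (y : L2 L) (α : ℝ) : StateSpace L μ κ := WithLp.toLp 2 (y, WeightedLine.toReal.symm α)

/-- The first component `y` of `(y, α)`. -/
def heat (U : StateSpace L μ κ) : L2 L := U.fst

/-- The second component `α` of `(y, α)`. -/
def ode (U : StateSpace L μ κ) : ℝ := WeightedLine.toReal U.snd

@[simp] lemma heat_mk (y : L2 L) (α : ℝ) : (mk y α : StateSpace L μ κ).heat = y := rfl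
@[simp] lemma ode_mk (y : L2 L) (α : ℝ) : (mk y α : StateSpace L μ κ).ode = α := rfl
@[simp] lemma heat_add (U V : StateSpace L μ κ) : (U + V).heat = U.heat + V.heat := rfl
@[simp] lemma ode_add (U V : StateSpace L μ κ) : (U + V).ode = U.ode + V.ode := rfl
@[simp] lemma heat_zero : (0 : StateSpace L μ κ).heat = 0 := rfl
@[simp] lemma ode_zero : (0 : StateSpace L μ κ).ode = 0 := rfl
@[simp] lemma heat_smul (c : ℝ) (U : StateSpace L μ κ) : (c • U).heat = c • U.heat := rfl
@[simp] lemma ode_smul (c : ℝ) (U : StateSpace L μ κ) : (c • U).ode = c * U.ode := rfl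

lemma mk_add (y z : L2 L) (α β : ℝ) :
    (mk (y + z) (α + β) : StateSpace L μ κ) = mk y α + mk z β := rfl

lemma mk_smul (c : ℝ) (y : L2 L) (α : ℝ) :
    (mk (c • y) (c * α) : StateSpace L μ κ) = c • mk y α := rfl

/-- The inner product of `ℋ` is `∫₀^L y φ dx + (μ/κ) α β`. -/
lemma inner_def [Fact (0 < μ * κ)] (U V : StateSpace L μ κ) :
    inner ℝ U V = (∫ x in Ioo 0 L, U.heat x * V.heat x) + μ / κ * (U.ode * V.ode) := by
  rw [WithLp.prod_inner_apply, L2.inner_def, WeightedLine.inner_def]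
  congr 1
  refine integral_congr_ae (Eventually.of_forall fun x => ?_)
  simp [heat, mul_comm]

end StateSpace

/-! ## The spaces `ℋ¹`, `ℋ²` and the operator -/

variable (L μ κ : ℝ)

/-- `ℋ¹ = {(y, α) ∈ H¹(0, L) × ℝ : y(0) = μ α}`. -/
def SpaceH1 : Submodule ℝ (StateSpace L μ κ) where
  carrier := {U | U.heat ∈ H1 L ∧ HasBoundaryValue U.heat 0 (μ * U.ode)}
  add_mem' := fun ⟨hU, hU'⟩ ⟨hV, hV'⟩ => ⟨add_mem hU hV, by
    simpa [mul_add] using hU'.add hV'⟩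
  zero_mem' := ⟨zero_mem _, by simpa using HasBoundaryValue.zero (L := L) 0⟩
  smul_mem' := fun c _ ⟨hU, hU'⟩ => ⟨(H1 L).smul_mem c hU, by
    simpa [mul_left_comm] using hU'.smul c⟩

/-- `ℋ² = {(y, α) ∈ H²(0, L) × ℝ : y(0) = μ α}`. -/
def SpaceH2 : Submodule ℝ (StateSpace L μ κ) where
  carrier := {U | U.heat ∈ H2 L ∧ HasBoundaryValue U.heat 0 (μ * U.ode)}
  add_mem' := fun ⟨hU, hU'⟩ ⟨hV, hV'⟩ => ⟨add_mem hU hV, by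
    simpa [mul_add] using hU'.add hV'⟩
  zero_mem' := ⟨zero_mem _, by simpa using HasBoundaryValue.zero (L := L) 0⟩
  smul_mem' := fun c _ ⟨hU, hU'⟩ => ⟨(H2 L).smul_mem c hU, by
    simpa [mul_left_comm] using hU'.smul c⟩

variable {L μ κ} in
/-- The norm of `ℋ¹`: `‖(y, α)‖² = ∫₀^L |y|² dx + ∫₀^L |y'|² dx + (μ/κ) α²`. -/
def normH1 (U : StateSpace L μ κ) : ℝ :=
  √((∫ x in Ioo 0 L, U.heat x ^ 2) + (∫ x in Ioo 0 L, weakDeriv U.heat x ^ 2)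
    + μ / κ * U.ode ^ 2)

/-- `D(𝒜) = {(y, α) ∈ ℋ² : y'(L) = 0}`. -/
def domainA : Submodule ℝ (StateSpace L μ κ) where
  carrier := {U | U ∈ SpaceH2 L μ κ ∧ HasBoundaryValue (weakDeriv U.heat) L 0}
  add_mem' := fun ⟨hU, hU'⟩ ⟨hV, hV'⟩ => ⟨add_mem hU hV, by
    rw [StateSpace.heat_add, weakDeriv_add hU.1.1 hV.1.1]
    simpa using hU'.add hV'⟩
  zero_mem' := ⟨zero_mem _, by
    rw [StateSpace.heat_zero, weakDeriv_zero]; exact HasBoundaryValue.zero L⟩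
  smul_mem' := fun c _ ⟨hU, hU'⟩ => ⟨(SpaceH2 L μ κ).smul_mem c hU, by
    rw [StateSpace.heat_smul, weakDeriv_smul c hU.1.1]
    simpa using hU'.smul c⟩

variable {L μ κ} in
lemma hasBoundaryValue_deriv_zero [hL : Fact (0 < L)] {U : StateSpace L μ κ}
    (hU : U ∈ domainA L μ κ) :
    HasBoundaryValue (weakDeriv U.heat) 0 (boundaryValue (weakDeriv U.heat) 0) := by
  obtain ⟨u, hu, hu', -⟩ := hU.2
  have h : HasBoundaryValue (weakDeriv U.heat) 0 (u 0) := ⟨u, hu, hu', rfl⟩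
  rwa [h.boundaryValue_eq hL.out (left_mem_Icc.2 hL.out.le)]

/-- The operator `𝒜 (y, α) = (y'', κ y'(0))` with domain `D(𝒜)`. -/
def opA [hL : Fact (0 < L)] [Fact (0 < μ * κ)] : StateSpace L μ κ →ₗ.[ℝ] StateSpace L μ κ where
  domain := domainA L μ κ
  toFun :=
    { toFun := fun U => StateSpace.mk (weakDeriv (weakDeriv U.1.heat))
        (κ * boundaryValue (weakDeriv U.1.heat) 0)
      map_add' := fun ⟨U, hU⟩ ⟨V, hV⟩ => by
        have h0 : (0 : ℝ) ∈ Icc 0 L := left_mem_Icc.2 hL.out.le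
        have hb := ((hasBoundaryValue_deriv_zero hU).add
          (hasBoundaryValue_deriv_zero hV)).boundaryValue_eq hL.out h0
        simp only [Submodule.coe_add, StateSpace.heat_add]
        rw [weakDeriv_add hU.1.1.1 hV.1.1.1, weakDeriv_add hU.1.1.2 hV.1.1.2, hb, mul_add,
          StateSpace.mk_add]
      map_smul' := fun c ⟨U, hU⟩ => by
        have h0 : (0 : ℝ) ∈ Icc 0 L := left_mem_Icc.2 hL.out.le
        have hb := ((hasBoundaryValue_deriv_zero hU).smul c).boundaryValue_eq hL.out h0
        simp only [Submodule.coe_smul, StateSpace.heat_smul, RingHom.id_apply]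
        rw [weakDeriv_smul c hU.1.1.1, weakDeriv_smul c hU.1.1.2, hb, mul_left_comm,
          StateSpace.mk_smul] }

end StateSpace

end HeatODE

end

/-! Let `V` be `ℋ¹` with the inner product `⟨U, W⟩_ℋ + ∫ y' w'`, and let `J : V → ℋ` be the
inclusion. When `U = (y, α) ∈ D(𝒜)` is tested against `W = (w, β) ∈ V`, integration by parts loses
the term at `L` because `y'(L) = 0`, and leaves `-y'(0) μ β = -(μ/κ) (κ y'(0)) β` at `0`, which is
the contribution of the weighted second component. Hence `∫ y' w' = -⟨𝒜U, W⟩_ℋ`, and conversely this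
identity for all `W` characterises `𝒜U`. In other words `(1 - 𝒜)⁻¹ = J J*` (`mem_graph_opA_iff`).

The map `J` is injective and contractive, has dense range, and is compact because `y = μ α + ∫₀ˣ y'`
exhibits it as a Volterra operator plus an operator of finite rank (`isCompactOperator_embed`). The
spectral theorem for `J J*` gives a Hilbert basis of eigenvectors with eigenvalues `r i ∈ (0, 1]`.
So `𝒜` acts on coordinates as multiplication by `-s i`, where `s i = 1 / r i - 1 ≥ 0`, and the norm
of `V` is `∑ (1 + s i) |x i|²` (`exists_isDiagonal`).

The assertions are then statements about sequences. A maximal real multiplication operator is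
self-adjoint; the semigroup is multiplication by `exp (-z s i)`, bounded by one for `Re z ≥ 0`. The
`K`-functional is comparable to a quadratic one that is minimised coordinate by coordinate;
integrating its minimum in `t` gives the weight `(π/2) √(1 + s i ^ 2)`, comparable to `1 + s i`
(`interpNorm_equiv`). -/

noncomputable section

/-! ### Multiplication operators in a Hilbert basis -/

namespace HilbertBasis

variable {ι H : Type*} [NormedAddCommGroup H] [InnerProductSpace ℝ H] (b : HilbertBasis ι ℝ H)

lemma repr_add_apply (x y : H) (i : ι) : b.repr (x + y) i = b.repr x i + b.repr y i := by
  rw [map_add]; rfl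

lemma repr_sub_apply (x y : H) (i : ι) : b.repr (x - y) i = b.repr x i - b.repr y i := by
  rw [map_sub]; rfl

lemma repr_smul_apply (c : ℝ) (x : H) (i : ι) : b.repr (c • x) i = c * b.repr x i := by
  rw [map_smul]; rfl

lemma hasSum_repr_sq (x : H) : HasSum (fun i => b.repr x i ^ 2) (‖x‖ ^ 2) := by
  have h := b.hasSum_inner_mul_inner x x
  rw [real_inner_self_eq_norm_sq] at h
  refine h.congr_fun fun i => ?_
  rw [b.repr_apply_apply, real_inner_comm x, sq]

lemma ext_repr {x y : H} (h : ∀ i, b.repr x i = b.repr y i) : x = y :=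
  b.repr.injective (lp.ext (funext h))

/-- Riesz–Fischer. Completeness of `H` need not be assumed, since `b.repr` is already an isometry
onto `ℓ²`. -/
lemma exists_repr_eq {a : ι → ℝ} (ha : Summable fun i => a i ^ 2) :
    ∃ x : H, ∀ i, b.repr x i = a i := by
  have hm : Memℓp a 2 := by
    rw [memℓp_gen_iff (by norm_num)]
    simpa using ha
  exact ⟨b.repr.symm ⟨a, hm⟩, fun i => by simp⟩

lemma norm_le_of_repr_le {x y : H} {C : ℝ} (hC : 0 ≤ C)
    (h : ∀ i, |b.repr y i| ≤ C * |b.repr x i|) : ‖y‖ ≤ C * ‖x‖ := by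
  refine le_of_sq_le_sq ?_ (by positivity)
  rw [mul_pow]
  refine hasSum_le (fun i => ?_) (b.hasSum_repr_sq y) ((b.hasSum_repr_sq x).mul_left (C ^ 2))
  rw [← sq_abs, ← sq_abs (b.repr x i), ← mul_pow]
  exact pow_le_pow_left₀ (abs_nonneg _) (h i) 2

lemma exists_repr_mul {m : ι → ℝ} {C : ℝ} (hm : ∀ i, |m i| ≤ C) (x : H) :
    ∃ y : H, ∀ i, b.repr y i = m i * b.repr x i := by
  refine b.exists_repr_eq (Summable.of_nonneg_of_le (fun i => sq_nonneg _) (fun i => ?_)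
    ((b.hasSum_repr_sq x).summable.mul_left (C ^ 2)))
  rw [mul_pow, ← sq_abs (m i)]
  exact mul_le_mul_of_nonneg_right (pow_le_pow_left₀ (abs_nonneg _) (hm i) 2) (sq_nonneg _)

open Classical in
/-- The bounded operator multiplying the coordinates in the Hilbert basis `b` by the bounded
family `m` (zero if `m` is unbounded). -/
def diag (m : ι → ℝ) : H →L[ℝ] H :=
  if hm : ∃ C, ∀ i, |m i| ≤ C then
    LinearMap.mkContinuousOfExistsBound
      { toFun := fun x => (b.exists_repr_mul hm.choose_spec x).choose
        map_add' := fun x y => b.ext_repr fun i => by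
          have h := fun x => (b.exists_repr_mul hm.choose_spec x).choose_spec
          refine (h (x + y) i).trans ?_
          rw [b.repr_add_apply x y, mul_add]
          exact ((b.repr_add_apply _ _ i).trans (congrArg₂ _ (h x i) (h y i))).symm
        map_smul' := fun c x => b.ext_repr fun i => by
          have h := fun x => (b.exists_repr_mul hm.choose_spec x).choose_spec
          refine (h (c • x) i).trans ?_
          rw [b.repr_smul_apply c x, mul_left_comm]
          exact ((b.repr_smul_apply _ _ i).trans (congrArg _ (h x i))).symm }
      -- Over an empty index type the chosen bound may be negative, hence the absolute value.
      ⟨|hm.choose|, fun x => b.norm_le_of_repr_le (abs_nonneg _) fun i => by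
        simp only [LinearMap.coe_mk, AddHom.coe_mk,
          (b.exists_repr_mul hm.choose_spec _).choose_spec, abs_mul]
        exact mul_le_mul_of_nonneg_right ((hm.choose_spec i).trans (le_abs_self _))
          (abs_nonneg _)⟩
  else 0

lemma repr_diag {m : ι → ℝ} {C : ℝ} (hm : ∀ i, |m i| ≤ C) (x : H) (i : ι) :
    b.repr (b.diag m x) i = m i * b.repr x i := by
  have h : ∃ C, ∀ i, |m i| ≤ C := ⟨C, hm⟩
  rw [diag, dif_pos h]
  exact (b.exists_repr_mul h.choose_spec x).choose_spec i

lemma norm_diag_le {m : ι → ℝ} {C : ℝ} (hC : 0 ≤ C) (hm : ∀ i, |m i| ≤ C) : ‖b.diag m‖ ≤ C := by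
  refine ContinuousLinearMap.opNorm_le_bound _ hC fun x => b.norm_le_of_repr_le hC fun i => ?_
  rw [b.repr_diag hm, abs_mul]
  exact mul_le_mul_of_nonneg_right (hm i) (abs_nonneg _)

lemma diag_one : b.diag (fun _ => 1) = ContinuousLinearMap.id ℝ H := by
  ext x
  refine b.ext_repr fun i => ?_
  rw [b.repr_diag (C := 1) (by simp)]
  simp

lemma diag_zero : b.diag (fun _ => 0) = 0 := by
  ext x
  refine b.ext_repr fun i => ?_
  rw [b.repr_diag (C := 0) (by simp)]
  simp

/-- Bounded pointwise convergence of the multipliers gives strong convergence. -/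
lemma tendsto_diag {α : Type*} {l : Filter α} {m : α → ι → ℝ} {m₀ : ι → ℝ} {C : ℝ}
    (hm : ∀ᶠ a in l, ∀ i, |m a i| ≤ C) (hm₀ : ∀ i, |m₀ i| ≤ C)
    (h : ∀ i, Tendsto (fun a => m a i) l (𝓝 (m₀ i))) (x : H) :
    Tendsto (fun a => b.diag (m a) x) l (𝓝 (b.diag m₀ x)) := by
  rw [tendsto_iff_norm_sub_tendsto_zero]
  -- By Parseval this sum is the squared norm of the difference; its terms tend to zero and are
  -- dominated by `(2 C)² |x i|²`.
  have key : Tendsto (fun a => ∑' i, ((m a i - m₀ i) * b.repr x i) ^ 2) l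
      (𝓝 (∑' _ : ι, (0 : ℝ))) := by
    refine tendsto_tsum_of_dominated_convergence
      ((b.hasSum_repr_sq x).summable.mul_left ((2 * C) ^ 2)) (fun i => ?_) ?_
    · have := (((h i).sub_const (m₀ i)).mul_const (b.repr x i)).pow 2
      simpa using this
    · filter_upwards [hm] with a ha i
      rw [Real.norm_eq_abs, abs_of_nonneg (sq_nonneg _), mul_pow, ← sq_abs (m a i - m₀ i)]
      refine mul_le_mul_of_nonneg_right (pow_le_pow_left₀ (abs_nonneg _) ?_ 2) (sq_nonneg _)
      calc |m a i - m₀ i| ≤ |m a i| + |m₀ i| := abs_sub _ _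
        _ ≤ 2 * C := by linarith [ha i, hm₀ i]
  rw [tsum_zero] at key
  have k2 := (Real.continuous_sqrt.tendsto 0).comp key
  rw [Real.sqrt_zero] at k2
  refine k2.congr' ?_
  filter_upwards [hm] with a ha
  rw [Function.comp_apply, Real.sqrt_eq_iff_mul_self_eq (tsum_nonneg fun i => sq_nonneg _)
    (norm_nonneg _), ← sq, ← (b.hasSum_repr_sq _).tsum_eq]
  refine tsum_congr fun i => ?_
  rw [b.repr_sub_apply, b.repr_diag ha, b.repr_diag hm₀, sub_mul]

end HilbertBasis

namespace HeatODE

/-! ### Complex multiplication operators on the complexification -/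

namespace Complexification

variable {ι E : Type*} [NormedAddCommGroup E]

lemma continuous_iff {α : Type*} [TopologicalSpace α] {f : α → Complexification E} :
    Continuous f ↔ Continuous (fun a => (f a).fst) ∧ Continuous fun a => (f a).snd := by
  constructor
  · exact fun h => ⟨(WithLp.continuous_fst 2 E E).comp h, (WithLp.continuous_snd 2 E E).comp h⟩
  · exact fun h => (WithLp.prod_continuous_toLp 2 E E).comp (h.1.prodMk h.2)

lemma tendsto_mk {α : Type*} {l : Filter α} {f g : α → E} {x y : E} (hf : Tendsto f l (𝓝 x))
    (hg : Tendsto g l (𝓝 y)) : Tendsto (fun a => mk (f a) (g a)) l (𝓝 (mk x y)) :=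
  ((WithLp.prod_continuous_toLp 2 E E).tendsto (x, y)).comp (hf.prodMk_nhds hg)

variable [InnerProductSpace ℝ E] (b : HilbertBasis ι ℝ E)

/-- The bounded operator on the complexification which multiplies the coordinates in the Hilbert
basis `b` by the bounded complex family `m`. -/
def diag (m : ι → ℂ) : Complexification E →L[ℂ] Complexification E where
  toFun u := mk (b.diag (fun i => (m i).re) u.fst - b.diag (fun i => (m i).im) u.snd)
    (b.diag (fun i => (m i).re) u.snd + b.diag (fun i => (m i).im) u.fst)
  map_add' u v := by ext <;> simp <;> abel
  map_smul' z u := by ext <;> simp <;> module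
  cont := by
    have h := (continuous_iff (E := E)).1 continuous_id
    simp only [id] at h
    have h1 := h.1
    have h2 := h.2
    exact continuous_iff.2 ⟨by simp only [fst_mk]; fun_prop, by simp only [snd_mk]; fun_prop⟩

lemma diag_apply (m : ι → ℂ) (u : Complexification E) : diag b m u =
    mk (b.diag (fun i => (m i).re) u.fst - b.diag (fun i => (m i).im) u.snd)
    (b.diag (fun i => (m i).re) u.snd + b.diag (fun i => (m i).im) u.fst) := rfl

lemma repr_fst_diag {m : ι → ℂ} {C : ℝ} (hm : ∀ i, ‖m i‖ ≤ C) (u : Complexification E) (i : ι) :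
    b.repr (diag b m u).fst i = (m i).re * b.repr u.fst i - (m i).im * b.repr u.snd i := by
  rw [diag_apply, fst_mk, map_sub, lp.coeFn_sub, Pi.sub_apply,
    b.repr_diag fun i => (Complex.abs_re_le_norm _).trans (hm i),
    b.repr_diag fun i => (Complex.abs_im_le_norm _).trans (hm i)]

lemma repr_snd_diag {m : ι → ℂ} {C : ℝ} (hm : ∀ i, ‖m i‖ ≤ C) (u : Complexification E) (i : ι) :
    b.repr (diag b m u).snd i = (m i).re * b.repr u.snd i + (m i).im * b.repr u.fst i := by
  rw [diag_apply, snd_mk, b.repr_add_apply,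
    b.repr_diag fun i => (Complex.abs_re_le_norm _).trans (hm i),
    b.repr_diag fun i => (Complex.abs_im_le_norm _).trans (hm i)]

lemma ext_repr {u v : Complexification E} (h₁ : ∀ i, b.repr u.fst i = b.repr v.fst i)
    (h₂ : ∀ i, b.repr u.snd i = b.repr v.snd i) : u = v :=
  Complexification.ext (b.ext_repr h₁) (b.ext_repr h₂)

lemma diag_mul {m n : ι → ℂ} {C D : ℝ} (hm : ∀ i, ‖m i‖ ≤ C) (hn : ∀ i, ‖n i‖ ≤ D) :
    diag b (fun i => m i * n i) = (diag b m).comp (diag b n) := by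
  have hmn : ∀ i, ‖m i * n i‖ ≤ C * D := fun i => by
    rw [norm_mul]
    exact mul_le_mul (hm i) (hn i) (norm_nonneg _) ((norm_nonneg _).trans (hm i))
  refine ContinuousLinearMap.ext fun u => ext_repr b (fun i => ?_) (fun i => ?_)
  · rw [repr_fst_diag b hmn, ContinuousLinearMap.comp_apply, repr_fst_diag b hm,
      repr_fst_diag b hn, repr_snd_diag b hn, Complex.mul_re, Complex.mul_im]
    ring
  · rw [repr_snd_diag b hmn, ContinuousLinearMap.comp_apply, repr_snd_diag b hm,
      repr_fst_diag b hn, repr_snd_diag b hn, Complex.mul_re, Complex.mul_im]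
    ring

lemma diag_add {m n : ι → ℂ} {C D : ℝ} (hm : ∀ i, ‖m i‖ ≤ C) (hn : ∀ i, ‖n i‖ ≤ D) :
    diag b (fun i => m i + n i) = diag b m + diag b n := by
  have hmn : ∀ i, ‖m i + n i‖ ≤ C + D := fun i =>
    (norm_add_le _ _).trans (add_le_add (hm i) (hn i))
  refine ContinuousLinearMap.ext fun u => ext_repr b (fun i => ?_) (fun i => ?_)
  · rw [repr_fst_diag b hmn, _root_.add_apply, fst_add, b.repr_add_apply,
      repr_fst_diag b hm, repr_fst_diag b hn, Complex.add_re, Complex.add_im]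
    ring
  · rw [repr_snd_diag b hmn, _root_.add_apply, snd_add, b.repr_add_apply,
      repr_snd_diag b hm, repr_snd_diag b hn, Complex.add_re, Complex.add_im]
    ring

lemma diag_const (z : ℂ) : diag b (fun _ => z) = z • ContinuousLinearMap.id ℂ _ := by
  refine ContinuousLinearMap.ext fun u => ext_repr b (fun i => ?_) (fun i => ?_)
  · rw [repr_fst_diag b (C := ‖z‖) (by simp)]; simp; rfl
  · rw [repr_snd_diag b (C := ‖z‖) (by simp)]; simp; rfl

lemma norm_diag_le {m : ι → ℂ} {C : ℝ} (hC : 0 ≤ C) (hm : ∀ i, ‖m i‖ ≤ C) : ‖diag b m‖ ≤ C := by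
  refine ContinuousLinearMap.opNorm_le_bound _ hC fun u => ?_
  refine le_of_sq_le_sq ?_ (by positivity)
  rw [mul_pow, norm_sq_eq, norm_sq_eq]
  refine hasSum_le (fun i => ?_) ((b.hasSum_repr_sq _).add (b.hasSum_repr_sq _))
    (((b.hasSum_repr_sq _).add (b.hasSum_repr_sq _)).mul_left (C ^ 2))
  rw [repr_fst_diag b hm, repr_snd_diag b hm]
  have h := pow_le_pow_left₀ (norm_nonneg _) (hm i) 2
  rw [Complex.sq_norm, Complex.normSq_apply] at h
  nlinarith [mul_le_mul_of_nonneg_right h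
    (add_nonneg (sq_nonneg (b.repr u.fst i)) (sq_nonneg (b.repr u.snd i)))]

lemma tendsto_diag {α : Type*} {l : Filter α} {m : α → ι → ℂ} {m₀ : ι → ℂ} {C : ℝ}
    (hm : ∀ᶠ a in l, ∀ i, ‖m a i‖ ≤ C) (hm₀ : ∀ i, ‖m₀ i‖ ≤ C)
    (h : ∀ i, Tendsto (fun a => m a i) l (𝓝 (m₀ i))) (u : Complexification E) :
    Tendsto (fun a => diag b (m a) u) l (𝓝 (diag b m₀ u)) := by
  have hre : ∀ v, Tendsto (fun a => b.diag (fun i => (m a i).re) v) l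
      (𝓝 (b.diag (fun i => (m₀ i).re) v)) :=
    b.tendsto_diag (hm.mono fun a ha i => (Complex.abs_re_le_norm _).trans (ha i))
      (fun i => (Complex.abs_re_le_norm _).trans (hm₀ i))
      fun i => (Complex.continuous_re.tendsto _).comp (h i)
  have him : ∀ v, Tendsto (fun a => b.diag (fun i => (m a i).im) v) l
      (𝓝 (b.diag (fun i => (m₀ i).im) v)) :=
    b.tendsto_diag (hm.mono fun a ha i => (Complex.abs_im_le_norm _).trans (ha i))
      (fun i => (Complex.abs_im_le_norm _).trans (hm₀ i))
      fun i => (Complex.continuous_im.tendsto _).comp (h i)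
  exact tendsto_mk ((hre _).sub (him _)) ((hre _).add (him _))

end Complexification

end HeatODE

end

/-! ### Diagonal operators: self-adjointness and generation -/

noncomputable section

namespace HeatODE

variable {ι H : Type*} [NormedAddCommGroup H] [InnerProductSpace ℝ H]

/-- `A` is the nonpositive self-adjoint operator with eigenvalues `-s i` and eigenvectors `b i`. -/
def IsDiagonal (A : H →ₗ.[ℝ] H) (b : HilbertBasis ι ℝ H) (s : ι → ℝ) : Prop :=
  ∀ x y : H, (x, y) ∈ A.graph ↔ ∀ i, b.repr y i = -s i * b.repr x i

namespace IsDiagonal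

variable {A : H →ₗ.[ℝ] H} {b : HilbertBasis ι ℝ H} {s : ι → ℝ}

lemma repr_apply (h : IsDiagonal A b s) (x : A.domain) (i : ι) :
    b.repr (A x) i = -s i * b.repr (x : H) i :=
  (h x (A x)).1 (A.mem_graph x) i

/-- Each basis vector is an eigenvector, hence lies in the domain, and the basis spans a dense
subspace. -/
lemma dense_domain (h : IsDiagonal A b s) : Dense (A.domain : Set H) := by
  classical
  have hb : Submodule.span ℝ (range b) ≤ A.domain := by
    rw [Submodule.span_le]
    rintro _ ⟨j, rfl⟩
    refine LinearPMap.mem_domain_of_mem_graph (y := -s j • b j) ((h _ _).2 fun i => ?_)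
    rw [b.repr_smul_apply, b.repr_self, lp.single_apply]
    rcases eq_or_ne i j with rfl | hij
    · simp
    · simp [hij]
  refine Dense.mono hb ?_
  rw [Submodule.dense_iff_topologicalClosure_eq_top]
  exact b.dense_span

lemma isFormalAdjoint (h : IsDiagonal A b s) : A.IsFormalAdjoint A := fun x y => by
  rw [← b.tsum_inner_mul_inner, ← b.tsum_inner_mul_inner]
  refine tsum_congr fun i => ?_
  rw [real_inner_comm (b i) (A x), real_inner_comm (b i) (x : H)]
  simp only [← b.repr_apply_apply]
  rw [h.repr_apply, h.repr_apply]
  ring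

/-- Symmetry gives `A ⊆ A*`. Conversely, pairing `A* x` with the eigenvector `b i` yields `⟨A* x, b
i⟩ = -s i ⟨x, b i⟩`; this is the condition for membership in the graph of `A`, whose domain is
maximal. -/
lemma isSelfAdjoint [CompleteSpace H] (h : IsDiagonal A b s) : IsSelfAdjoint A := by
  classical
  rw [LinearPMap.isSelfAdjoint_def]
  refine LinearPMap.eq_of_eq_graph (le_antisymm ?_
    (LinearPMap.le_graph_of_le (h.isFormalAdjoint.le_adjoint h.dense_domain)))
  rintro ⟨x, y⟩ hxy
  refine (h x y).2 fun i => ?_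
  obtain ⟨⟨x, hx⟩, rfl, rfl⟩ := (LinearPMap.mem_graph_iff _).1 hxy
  have hg : (b i, -s i • b i) ∈ A.graph := (h _ _).2 fun j => by
    rw [b.repr_smul_apply, b.repr_self, lp.single_apply]
    rcases eq_or_ne j i with rfl | hij
    · simp
    · simp [hij]
  obtain ⟨v, hv, hv'⟩ := (LinearPMap.mem_graph_iff _).1 hg
  have := A.adjoint_isFormalAdjoint h.dense_domain ⟨x, hx⟩ v
  simp only at hv hv'
  rw [hv, hv', real_inner_smul_right, real_inner_comm, real_inner_comm (b i) x] at this
  rw [b.repr_apply_apply, b.repr_apply_apply, ← this]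

/-! ### The semigroup -/

lemma abs_exp_le (hs : ∀ i, 0 ≤ s i) {t : ℝ} (ht : 0 ≤ t) (i : ι) :
    |Real.exp (-(t * s i))| ≤ 1 := by
  rw [Real.abs_exp, Real.exp_le_one_iff, neg_nonpos]
  exact mul_nonneg ht (hs i)

lemma isC0Semigroup_diag (hs : ∀ i, 0 ≤ s i) (b : HilbertBasis ι ℝ H) :
    IsC0Semigroup fun t => b.diag fun i => Real.exp (-(t * s i)) where
  map_zero := by simpa using b.diag_one
  map_add t t' ht ht' := by
    ext x
    refine b.ext_repr fun i => ?_
    rw [b.repr_diag (abs_exp_le hs (add_nonneg ht ht')), ContinuousLinearMap.comp_apply,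
      b.repr_diag (abs_exp_le hs ht), b.repr_diag (abs_exp_le hs ht'), ← mul_assoc, ← Real.exp_add]
    ring_nf
  continuousOn x t ht := by
    refine b.tendsto_diag (C := 1) ?_ (abs_exp_le hs ht) (fun i => ?_) x
    · filter_upwards [self_mem_nhdsWithin] with t' ht' using abs_exp_le hs ht'
    · exact Continuous.continuousWithinAt (by fun_prop)

lemma tendsto_inv_mul_exp_sub_one (c : ℝ) :
    Tendsto (fun t : ℝ => t⁻¹ * (Real.exp (-(t * c)) - 1)) (𝓝[>] 0) (𝓝 (-c)) := by
  have h : HasDerivAt (fun t : ℝ => Real.exp (-(t * c))) (-c) 0 := by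
    simpa using ((hasDerivAt_id (0 : ℝ)).mul_const c).neg.exp
  have := h.tendsto_slope_zero_right
  simpa using this

/-- If `y = A x`, then `x - y` has coordinates `(1 + s i) x i`. The difference quotient at `x` is
therefore the image of the fixed vector `x - y` under the multipliers `t⁻¹ (exp (-t s i) - 1) / (1 +
s i)`, which are bounded by one and converge for each `i`. For the converse it suffices to pass to
the limit in each coordinate. -/
lemma isGenerator_diag (hs : ∀ i, 0 ≤ s i) (h : IsDiagonal A b s) :
    IsGenerator A fun t => b.diag fun i => Real.exp (-(t * s i)) := by
  intro x y
  constructor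
  · intro hxy
    have hy := (h x y).1 hxy
    have hw : ∀ i, b.repr (x - y) i = (1 + s i) * b.repr x i := fun i => by
      rw [b.repr_sub_apply, hy]; ring
    have hpos : ∀ i, 0 < 1 + s i := fun i => by linarith [hs i]
    have hlim : ∀ i, |-s i / (1 + s i)| ≤ 1 := fun i => by
      rw [abs_div, abs_neg, abs_of_nonneg (hs i), abs_of_pos (hpos i), div_le_one (hpos i)]
      linarith
    have hbd : ∀ t > 0, ∀ i, |t⁻¹ * (Real.exp (-(t * s i)) - 1) / (1 + s i)| ≤ 1 := by
      intro t ht i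
      have h1 : Real.exp (-(t * s i)) ≤ 1 :=
        Real.exp_le_one_iff.2 (neg_nonpos.2 (mul_nonneg ht.le (hs i)))
      have h2 := Real.add_one_le_exp (-(t * s i))
      rw [abs_div, abs_mul, abs_of_pos (inv_pos.2 ht), abs_of_pos (hpos i), div_le_one (hpos i),
        abs_of_nonpos (by linarith), inv_mul_le_iff₀ ht]
      nlinarith
    have key := b.tendsto_diag (l := 𝓝[>] (0 : ℝ)) (C := 1)
      (eventually_mem_nhdsWithin.mono fun t ht => hbd t ht) hlim
      (fun i => (tendsto_inv_mul_exp_sub_one (s i)).div_const _) (x - y)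
    convert key.congr' ?_ using 2
    · refine b.ext_repr fun i => ?_
      rw [b.repr_diag hlim, hw, hy]
      field_simp [(hpos i).ne']
    · filter_upwards [self_mem_nhdsWithin] with t ht
      refine b.ext_repr fun i => ?_
      rw [b.repr_diag (hbd t ht), hw, b.repr_smul_apply, b.repr_sub_apply,
        b.repr_diag (abs_exp_le hs (le_of_lt ht))]
      field_simp [(hpos i).ne']
  · intro hlim
    refine (h x y).2 fun i => ?_
    have h1 := ((innerSL ℝ (b i)).continuous.tendsto y).comp hlim
    have h2 := (tendsto_inv_mul_exp_sub_one (s i)).mul_const (b.repr x i)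
    have h3 : b.repr y i = innerSL ℝ (b i) y := by
      rw [innerSL_apply_apply, b.repr_apply_apply]
    rw [h3]
    refine tendsto_nhds_unique h1 (h2.congr' ?_)
    filter_upwards [self_mem_nhdsWithin] with t ht
    rw [Function.comp_apply, innerSL_apply_apply, ← b.repr_apply_apply, b.repr_smul_apply,
      b.repr_sub_apply, b.repr_diag (abs_exp_le hs (le_of_lt ht))]
    ring

lemma re_pos_of_mem_sector {δ : ℝ} (hδ : δ ≤ Real.pi / 2) {z : ℂ} (hz : z ∈ sector δ) :
    0 < z.re :=
  (Complex.abs_arg_lt_pi_div_two_iff.1 (hz.2.trans_le hδ)).resolve_right hz.1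

lemma norm_exp_neg_mul (z : ℂ) (c : ℝ) :
    ‖Complex.exp (-(z * c))‖ = Real.exp (-(z.re * c)) := by
  rw [Complex.norm_exp]
  simp

/-- Follows from `1 + u + u² / 2 ≤ exp u` at `u = ε c`. -/
lemma sq_mul_exp_neg_le {ε c : ℝ} (hε : 0 < ε) (hc : 0 ≤ c) :
    c ^ 2 * Real.exp (-(ε * c)) ≤ 2 / ε ^ 2 := by
  have h := Real.quadratic_le_exp_of_nonneg (mul_nonneg hε.le hc)
  rw [Real.exp_neg, ← div_eq_mul_inv, div_le_div_iff₀ (Real.exp_pos _) (by positivity)]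
  nlinarith [mul_nonneg hε.le hc]

lemma mul_exp_neg_le {ε c : ℝ} (hε : 0 < ε) : c * Real.exp (-(ε * c)) ≤ 1 / ε := by
  have h := Real.add_one_le_exp (ε * c)
  rw [Real.exp_neg, ← div_eq_mul_inv, div_le_div_iff₀ (Real.exp_pos _) hε]
  linarith

/-- A second-order Taylor bound uniform in `c`. After factoring out `exp (-z c)`, one half of the
decay `exp (-c Re z)` absorbs the growth `exp (c ‖w - z‖)` of the remainder, and the other half
absorbs the factor `c²`; `8 / (Re z)²` is `2 / ε²` at `ε = Re z / 2`. -/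
lemma norm_exp_taylor_le {z w : ℂ} {c : ℝ} (hc : 0 ≤ c) (hz : 0 < z.re)
    (hw : ‖w - z‖ ≤ z.re / 2) :
    ‖Complex.exp (-(w * c)) - Complex.exp (-(z * c))
      - (w - z) * (-c * Complex.exp (-(z * c)))‖ ≤ 8 / z.re ^ 2 * ‖w - z‖ ^ 2 := by
  have e : Complex.exp (-(w * c)) - Complex.exp (-(z * c))
      - (w - z) * (-c * Complex.exp (-(z * c))) = Complex.exp (-(z * c)) *
        (Complex.exp (-((w - z) * c)) - (1 + -((w - z) * c))) := by
    have : Complex.exp (-(w * c)) = Complex.exp (-(z * c)) * Complex.exp (-((w - z) * c)) := by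
      rw [← Complex.exp_add]; ring_nf
    rw [this]; ring
  have ht := Complex.norm_exp_sub_sum_le_norm_mul_exp (-((w - z) * c)) 2
  simp only [Finset.sum_range_succ, Finset.range_zero, Finset.sum_empty, pow_zero, pow_one,
    Nat.factorial_zero, Nat.factorial_one, Nat.cast_one, div_one, zero_add] at ht
  have hn : ‖-((w - z) * c)‖ = ‖w - z‖ * c := by
    rw [norm_neg, norm_mul, Complex.norm_real, Real.norm_of_nonneg hc]
  rw [hn] at ht
  rw [e, norm_mul, norm_exp_neg_mul]
  calc _ ≤ Real.exp (-(z.re * c)) * ((‖w - z‖ * c) ^ 2 * Real.exp (‖w - z‖ * c)) := by gcongr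
    _ ≤ Real.exp (-(z.re * c)) * ((‖w - z‖ * c) ^ 2 * Real.exp (z.re / 2 * c)) := by gcongr
    _ = ‖w - z‖ ^ 2 * (c ^ 2 * Real.exp (-(z.re / 2 * c))) := by
      have : Real.exp (-(z.re / 2 * c)) = Real.exp (-(z.re * c)) * Real.exp (z.re / 2 * c) := by
        rw [← Real.exp_add]; ring_nf
      rw [this]; ring
    _ ≤ ‖w - z‖ ^ 2 * (2 / (z.re / 2) ^ 2) := by
      gcongr
      exact sq_mul_exp_neg_le (by positivity) hc
    _ = _ := by ring

lemma norm_cexp_le (hs : ∀ i, 0 ≤ s i) {z : ℂ} (hz : 0 ≤ z.re) (i : ι) :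
    ‖Complex.exp (-(z * s i))‖ ≤ 1 := by
  rw [norm_exp_neg_mul, Real.exp_le_one_iff, neg_nonpos]
  exact mul_nonneg hz (hs i)

/-- A multiplier's operator norm is at most any uniform bound on its entries, so the Taylor bound,
uniform in `s i`, gives differentiability in operator norm although the `s i` may be unbounded. -/
lemma hasDerivAt_diag_exp (hs : ∀ i, 0 ≤ s i) (b : HilbertBasis ι ℝ H) {z : ℂ} (hz : 0 < z.re) :
    HasDerivAt (fun w => Complexification.diag b fun i => Complex.exp (-(w * s i)))
      (Complexification.diag b fun i => -s i * Complex.exp (-(z * s i))) z := by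
  rw [hasDerivAt_iff_isLittleO]
  have hO : (fun w => Complexification.diag b (fun i => Complex.exp (-(w * s i)))
      - Complexification.diag b (fun i => Complex.exp (-(z * s i)))
      - (w - z) • Complexification.diag b (fun i => -s i * Complex.exp (-(z * s i))))
      =O[𝓝 z] fun w => ‖w - z‖ ^ 2 := by
    refine Asymptotics.IsBigO.of_bound (8 / z.re ^ 2) ?_
    filter_upwards [Metric.closedBall_mem_nhds z (half_pos hz)] with w hw
    rw [mem_closedBall_iff_norm] at hw
    have hwre : 0 ≤ w.re := by
      have h1 := (Complex.abs_re_le_norm (w - z)).trans hw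
      rw [Complex.sub_re] at h1
      linarith [(abs_le.1 h1).1]
    have hd : ∀ i, ‖-(s i : ℂ) * Complex.exp (-(z * s i))‖ ≤ 1 / z.re := fun i => by
      rw [norm_mul, norm_neg, Complex.norm_real, Real.norm_of_nonneg (hs i), norm_exp_neg_mul]
      exact mul_exp_neg_le hz
    have hd' : ∀ i, ‖(w - z) * (-(s i : ℂ) * Complex.exp (-(z * s i)))‖ ≤ ‖w - z‖ * (1 / z.re) :=
      fun i => by
        rw [norm_mul]
        exact mul_le_mul_of_nonneg_left (hd i) (norm_nonneg _)
    have hr := fun i => norm_exp_taylor_le (hs i) hz hw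
    -- Written as remainder plus (value plus linear term), each a bounded family, so that additivity
    -- of multipliers applies.
    have e := Complexification.diag_add b hr
      (fun i => (norm_add_le _ _).trans (add_le_add (norm_cexp_le hs hz.le i) (hd' i)))
    rw [Complexification.diag_add b (norm_cexp_le hs hz.le) hd',
      Complexification.diag_mul b (fun _ => le_rfl) hd, Complexification.diag_const] at e
    have e' : Complexification.diag b (fun i => Complex.exp (-(w * s i)))
      - Complexification.diag b (fun i => Complex.exp (-(z * s i)))
      - (w - z) • Complexification.diag b (fun i => -s i * Complex.exp (-(z * s i)))
      = Complexification.diag b (fun i => Complex.exp (-(w * s i)) - Complex.exp (-(z * s i))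
      - (w - z) * (-s i * Complex.exp (-(z * s i)))) := by
      rw [sub_sub, sub_eq_iff_eq_add]
      convert e using 2
      · funext i; ring
      · rw [ContinuousLinearMap.smul_comp, ContinuousLinearMap.id_comp]
    rw [e']
    refine Complexification.norm_diag_le b (by positivity) fun i => ?_
    simpa using hr i
  refine hO.trans_isLittleO ?_
  have : (fun w : ℂ => ‖w - z‖ ^ 2) =o[𝓝 z] fun w => ‖w - z‖ ^ 1 := by
    have h0 : Tendsto (fun w : ℂ => ‖w - z‖) (𝓝 z) (𝓝 0) := by
      have : Continuous fun w : ℂ => ‖w - z‖ := by fun_prop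
      simpa using this.tendsto z
    exact (Asymptotics.isLittleO_pow_pow one_lt_two).comp_tendsto h0
  exact (this.trans_isBigO (by simpa using Asymptotics.isBigO_refl _ _)).of_norm_right

/-- The sector of angle `π / 2` is the open right half-plane, where all multipliers `exp (-z s i)`
have modulus at most one; strong convergence at `0` follows from this bound and convergence for each
`i`. -/
lemma isAnalyticSemigroup_diag (hs : ∀ i, 0 ≤ s i) (b : HilbertBasis ι ℝ H) :
    IsAnalyticSemigroup (Real.pi / 2)
      fun z => Complexification.diag b fun i => Complex.exp (-(z * s i)) where
  map_zero := by simpa using Complexification.diag_const b 1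
  map_add z hz w hw := by
    have hz' := (re_pos_of_mem_sector le_rfl hz).le
    have hw' := (re_pos_of_mem_sector le_rfl hw).le
    rw [← Complexification.diag_mul b (norm_cexp_le hs hz') (norm_cexp_le hs hw')]
    congr 1
    funext i
    rw [← Complex.exp_add]
    ring_nf
  differentiableOn z hz :=
    (hasDerivAt_diag_exp hs b (re_pos_of_mem_sector le_rfl hz)).differentiableAt
      |>.differentiableWithinAt
  tendsto δ' _ hδ' x := by
    have h := Complexification.tendsto_diag b (l := 𝓝[sector δ'] 0) (C := 1)
      (m := fun z i => Complex.exp (-(z * s i))) (m₀ := fun _ => 1)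
      (eventually_mem_nhdsWithin.mono fun z hz =>
        norm_cexp_le hs (re_pos_of_mem_sector hδ'.le hz).le)
      (by simp) (fun i => ?_) x
    · rwa [Complexification.diag_const, one_smul] at h
    · have : Continuous fun z : ℂ => Complex.exp (-(z * s i)) := by fun_prop
      simpa using (this.tendsto 0).mono_left nhdsWithin_le_nhds

/-- A nonpositive diagonal operator generates an analytic semigroup. -/
lemma generatesAnalyticC0Semigroup (hs : ∀ i, 0 ≤ s i) (h : IsDiagonal A b s) :
    GeneratesAnalyticC0Semigroup A := by
  refine ⟨_, isC0Semigroup_diag hs b, isGenerator_diag hs h, Real.pi / 2, by positivity, le_rfl, _,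
    isAnalyticSemigroup_diag hs b, fun t _ x y => ?_⟩
  have e : ∀ i, Complex.exp (-(t * s i)) = (Real.exp (-(t * s i)) : ℝ) := fun i => by
    push_cast; rfl
  simp only [e, Complexification.diag_apply, Complex.ofReal_re, Complex.ofReal_im, b.diag_zero]
  simp

end IsDiagonal

end HeatODE

end

/-! ### Real interpolation for diagonal operators -/

noncomputable section

namespace HeatODE

/-- The index type of a Hilbert basis may be uncountable, but a given vector has only countably many
nonzero coordinates; this reduces the exchange to the countable case. -/
lemma lintegral_tsum_of_countable {ι α : Type*} [MeasurableSpace α] {ν : Measure α}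
    {f : ι → α → ℝ≥0∞} {S : Set ι} (hS : S.Countable) (h0 : ∀ i ∉ S, ∀ a, f i a = 0)
    (hf : ∀ i, Measurable (f i)) :
    ∫⁻ a, ∑' i, f i a ∂ν = ∑' i, ∫⁻ a, f i a ∂ν := by
  have : Countable S := hS.to_subtype
  have e1 : ∀ a, ∑' i, f i a = ∑' i : S, f i a := fun a =>
    (tsum_subtype_eq_of_support_subset fun i hi => by
      by_contra hiS
      exact hi (h0 i hiS a)).symm
  have e2 : ∑' i, ∫⁻ a, f i a ∂ν = ∑' i : S, ∫⁻ a, f i a ∂ν :=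
    (tsum_subtype_eq_of_support_subset (f := fun i => ∫⁻ a, f i a ∂ν) fun i hi => by
      by_contra hiS
      exact hi (by simp [h0 i hiS])).symm
  simp_rw [e1]
  rw [e2]
  exact lintegral_tsum fun i : S => (hf i).aemeasurable

/-- The substitution `u = √q t` reduces this to `∫₀^∞ du / (1 + u²) = π / 2`. -/
lemma lintegral_Ioi_div_one_add {q : ℝ} (hq : 0 < q) :
    ∫⁻ t in Ioi (0 : ℝ), ENNReal.ofReal (q / (1 + t ^ 2 * q))
      = ENNReal.ofReal (Real.pi / 2 * √q) := by
  have e : ∀ t : ℝ, q / (1 + t ^ 2 * q) = q * (1 + (√q * t) ^ 2)⁻¹ := fun t => by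
    rw [mul_pow, Real.sq_sqrt hq.le, div_eq_mul_inv]; ring_nf
  have hint : Integrable fun t : ℝ => q / (1 + t ^ 2 * q) := by
    simp_rw [e]
    exact (integrable_inv_one_add_sq.comp_mul_left' (Real.sqrt_pos.2 hq).ne').const_mul q
  rw [← ofReal_integral_eq_lintegral_ofReal hint.integrableOn
    (Eventually.of_forall fun t => by positivity)]
  congr 1
  simp_rw [e]
  rw [integral_const_mul, integral_comp_mul_left_Ioi (fun u => (1 + u ^ 2)⁻¹) 0
    (Real.sqrt_pos.2 hq), mul_zero, integral_Ioi_inv_one_add_sq, Real.arctan_zero, smul_eq_mul,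
    sub_zero]
  have := Real.mul_self_sqrt hq.le
  have h' := (Real.sqrt_pos.2 hq).ne'
  field_simp
  linarith

namespace IsDiagonal

variable {ι H : Type*} [NormedAddCommGroup H] [InnerProductSpace ℝ H]
  {A : H →ₗ.[ℝ] H} {b : HilbertBasis ι ℝ H} {s : ι → ℝ}

/-- The minimum of `‖x - v‖² + t² (‖v‖² + ‖A v‖²)` over `v ∈ D(A)`, for the diagonal operator `A`
with eigenvalues `-s i`. -/
def minFunctional (b : HilbertBasis ι ℝ H) (s : ι → ℝ) (t : ℝ) (x : H) : ℝ :=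
  ∑' i, t ^ 2 * ((1 + s i ^ 2) / (1 + t ^ 2 * (1 + s i ^ 2)) * b.repr x i ^ 2)

lemma summable_minFunctional (b : HilbertBasis ι ℝ H) (s : ι → ℝ) (t : ℝ) (x : H) :
    Summable fun i => t ^ 2 * ((1 + s i ^ 2) / (1 + t ^ 2 * (1 + s i ^ 2)) * b.repr x i ^ 2) := by
  refine (b.hasSum_repr_sq x).summable.of_nonneg_of_le (fun i => by positivity) fun i => ?_
  rw [← mul_assoc, ← mul_div_assoc]
  refine mul_le_of_le_one_left (sq_nonneg _) ?_
  rw [div_le_one (by positivity)]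
  linarith

lemma hasSum_penalized (h : IsDiagonal A b s) (t : ℝ) (x : H) (v : A.domain) :
    HasSum (fun i => (b.repr x i - b.repr (v : H) i) ^ 2
      + t ^ 2 * (1 + s i ^ 2) * b.repr (v : H) i ^ 2)
      (‖x - v‖ ^ 2 + t ^ 2 * (‖(v : H)‖ ^ 2 + ‖A v‖ ^ 2)) := by
  refine ((b.hasSum_repr_sq (x - v)).add
    (((b.hasSum_repr_sq (v : H)).add (b.hasSum_repr_sq (A v))).mul_left (t ^ 2))).congr_fun
    fun i => ?_
  rw [b.repr_sub_apply, h.repr_apply]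
  ring

/-- Completion of the square in each coordinate: with `a = t² (1 + s²)`, `(1 + a) ((x - v)² + a v²)
- a x² = (x - v - a v)²`. -/
lemma minFunctional_le (h : IsDiagonal A b s) (t : ℝ) (x : H) (v : A.domain) :
    minFunctional b s t x ≤ ‖x - v‖ ^ 2 + t ^ 2 * (‖(v : H)‖ ^ 2 + ‖A v‖ ^ 2) := by
  refine hasSum_le (fun i => ?_) (summable_minFunctional b s t x).hasSum (h.hasSum_penalized t x v)
  rw [← mul_assoc, ← mul_div_assoc, div_mul_eq_mul_div, div_le_iff₀ (by positivity)]
  nlinarith [sq_nonneg (b.repr x i - b.repr (v : H) i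
    - t ^ 2 * (1 + s i ^ 2) * b.repr (v : H) i)]

/-- The square in `minFunctional_le` vanishes for `v i = x i / (1 + t² (1 + s i ²))`. This vector
lies in `D(A)` because `t |s| ≤ 1 + t² (1 + s²)` bounds the multipliers of `A v` by `1 / t`. -/
lemma exists_eq_minFunctional (h : IsDiagonal A b s) {t : ℝ} (ht : 0 < t) (x : H) :
    ∃ v : A.domain,
      ‖x - v‖ ^ 2 + t ^ 2 * (‖(v : H)‖ ^ 2 + ‖A v‖ ^ 2) = minFunctional b s t x := by
  have hpos : ∀ i, 0 < 1 + t ^ 2 * (1 + s i ^ 2) := fun i => by positivity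
  obtain ⟨v, hv⟩ := b.exists_repr_mul (m := fun i => 1 / (1 + t ^ 2 * (1 + s i ^ 2))) (C := 1)
    (fun i => by
      rw [abs_of_nonneg (by positivity), div_le_one (hpos i)]
      have : 0 ≤ t ^ 2 * (1 + s i ^ 2) := by positivity
      linarith) x
  obtain ⟨w, hw⟩ := b.exists_repr_mul (m := fun i => -s i / (1 + t ^ 2 * (1 + s i ^ 2)))
    (C := 1 / t) (fun i => by
      rw [abs_div, abs_neg, abs_of_pos (hpos i), div_le_div_iff₀ (hpos i) ht, ← sq_abs (s i)]
      nlinarith [sq_nonneg (t * |s i| - 1), sq_nonneg t]) x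
  have hg : (v, w) ∈ A.graph := (h v w).2 fun i => by rw [hv, hw]; ring
  refine ⟨⟨v, LinearPMap.mem_domain_of_mem_graph hg⟩, ?_⟩
  rw [← (h.hasSum_penalized t x _).tsum_eq]
  refine tsum_congr fun i => ?_
  simp only [hv]
  have := (hpos i).ne'
  field_simp
  ring

/-- For nonnegative terms the sum of squares is at most the square of the sum. -/
lemma kFunctional_sq_ge (h : IsDiagonal A b s) {t : ℝ} (ht : 0 < t) (x : H) :
    ENNReal.ofReal (minFunctional b s t x) ≤ kFunctional A.domain (graphNorm A) t x ^ 2 := by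
  have hm : 0 ≤ minFunctional b s t x := tsum_nonneg fun i => by positivity
  rw [← Real.sq_sqrt hm, ENNReal.ofReal_pow (Real.sqrt_nonneg _)]
  refine pow_le_pow_left₀ zero_le (le_iInf fun v => ENNReal.ofReal_le_ofReal ?_) 2
  rw [graphNorm]
  refine Real.sqrt_le_iff.2 ⟨by positivity, (h.minFunctional_le t x v).trans ?_⟩
  have h1 : 0 ≤ ‖x - v‖ * (t * (‖(v : H)‖ + ‖A v‖)) := by positivity
  have h2 : 0 ≤ t ^ 2 * (‖(v : H)‖ * ‖A v‖) := by positivity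
  nlinarith

/-- The quadratic minimiser is used as a competitor in `K`; the factor `3` is Cauchy–Schwarz for the
three terms `‖x - v‖`, `t ‖v‖`, `t ‖A v‖`. -/
lemma kFunctional_sq_le (h : IsDiagonal A b s) {t : ℝ} (ht : 0 < t) (x : H) :
    kFunctional A.domain (graphNorm A) t x ^ 2 ≤ 3 * ENNReal.ofReal (minFunctional b s t x) := by
  obtain ⟨v, hv⟩ := h.exists_eq_minFunctional ht x
  calc kFunctional A.domain (graphNorm A) t x ^ 2
      ≤ ENNReal.ofReal (‖x - v‖ + t * graphNorm A v) ^ 2 :=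
        pow_le_pow_left₀ zero_le (iInf_le _ v) 2
    _ = ENNReal.ofReal ((‖x - v‖ + t * graphNorm A v) ^ 2) := by
      rw [ENNReal.ofReal_pow]
      unfold graphNorm
      positivity
    _ ≤ ENNReal.ofReal (3 * minFunctional b s t x) := by
      refine ENNReal.ofReal_le_ofReal ?_
      rw [← hv, graphNorm]
      nlinarith [sq_nonneg (‖x - v‖ - t * ‖(v : H)‖), sq_nonneg (‖x - v‖ - t * ‖A v‖),
        sq_nonneg (t * ‖(v : H)‖ - t * ‖A v‖)]
    _ = _ := by
      rw [ENNReal.ofReal_mul (by norm_num)]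
      norm_num

lemma interp_integrand_eq {t : ℝ} (ht : 0 < t) (K : ℝ≥0∞) :
    (ENNReal.ofReal (t ^ (-(1 / 2) : ℝ)) * K) ^ (2 : ℝ) * ENNReal.ofReal t⁻¹
      = ENNReal.ofReal (t ^ 2)⁻¹ * K ^ 2 := by
  rw [ENNReal.mul_rpow_of_nonneg _ _ zero_le_two, ENNReal.rpow_two, ENNReal.rpow_two,
    ← ENNReal.ofReal_pow (by positivity), mul_right_comm,
    ← ENNReal.ofReal_mul (by positivity), ← Real.rpow_natCast, ← Real.rpow_mul ht.le]
  congr 2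
  norm_num [Real.rpow_neg_one]
  ring

/-- The weight `t⁻²` cancels the factor `t²` of the minimum, so each coordinate contributes the
integral of `q / (1 + t² q)` with `q = 1 + s i ²`. -/
lemma lintegral_minFunctional (b : HilbertBasis ι ℝ H) (s : ι → ℝ) (x : H) :
    ∫⁻ t in Ioi (0 : ℝ), ENNReal.ofReal (t ^ 2)⁻¹ * ENNReal.ofReal (minFunctional b s t x)
      = ∑' i, ENNReal.ofReal (Real.pi / 2 * √(1 + s i ^ 2) * b.repr x i ^ 2) := by
  have e : ∀ t ∈ Ioi (0 : ℝ), ENNReal.ofReal (t ^ 2)⁻¹ * ENNReal.ofReal (minFunctional b s t x)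
      = ∑' i, ENNReal.ofReal ((1 + s i ^ 2) / (1 + t ^ 2 * (1 + s i ^ 2)) * b.repr x i ^ 2) := by
    intro t ht
    have ht' : t ^ 2 ≠ 0 := pow_ne_zero 2 (ne_of_gt ht)
    have hs := (summable_minFunctional b s t x).mul_left (t ^ 2)⁻¹
    simp_rw [inv_mul_cancel_left₀ ht'] at hs
    rw [← ENNReal.ofReal_mul (by positivity), minFunctional, ← tsum_mul_left]
    simp_rw [inv_mul_cancel_left₀ ht']
    exact ENNReal.ofReal_tsum_of_nonneg (fun i => by positivity) hs
  rw [setLIntegral_congr_fun measurableSet_Ioi e,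
    lintegral_tsum_of_countable (b.hasSum_repr_sq x).summable.countable_support
      (fun i hi t => by rw [Function.notMem_support.1 hi]; simp) (fun i => by fun_prop)]
  refine tsum_congr fun i => ?_
  have : ∀ t : ℝ, ENNReal.ofReal ((1 + s i ^ 2) / (1 + t ^ 2 * (1 + s i ^ 2)) * b.repr x i ^ 2)
      = ENNReal.ofReal ((1 + s i ^ 2) / (1 + t ^ 2 * (1 + s i ^ 2)))
        * ENNReal.ofReal (b.repr x i ^ 2) := fun t => ENNReal.ofReal_mul (by positivity)
  simp_rw [this]
  rw [lintegral_mul_const _ (by fun_prop), lintegral_Ioi_div_one_add (by positivity),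
    ← ENNReal.ofReal_mul (by positivity)]

lemma sqrt_one_add_sq_le {c : ℝ} (hc : 0 ≤ c) : √(1 + c ^ 2) ≤ 1 + c :=
  Real.sqrt_le_iff.2 ⟨by positivity, by nlinarith⟩

/-- With `sqrt_one_add_sq_le` this exchanges the weight `√(1 + s²)` for the form weight `1 + s`. The
factor `1 / 2` turns `π / 2` into `π / 4` below, and the `3` of `kFunctional_sq_le` turns it into `3
π / 2` above. -/
lemma le_sqrt_one_add_sq (c : ℝ) : (1 + c) / 2 ≤ √(1 + c ^ 2) :=
  Real.le_sqrt_of_sq_le (by nlinarith [sq_nonneg (1 - c), sq_nonneg c])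

lemma interpNorm_eq (Y : Submodule ℝ H) (N : Y → ℝ) (x : H) :
    interpNorm Y N (1 / 2) 2 x = (∫⁻ t in Ioi (0 : ℝ),
      ENNReal.ofReal (t ^ 2)⁻¹ * kFunctional Y N t x ^ 2) ^ (1 / 2 : ℝ) := by
  rw [interpNorm, setLIntegral_congr_fun measurableSet_Ioi fun t ht => interp_integrand_eq ht _]

lemma interpNorm_ge (h : IsDiagonal A b s) (x : H) :
    (ENNReal.ofReal (Real.pi / 4) * ∑' i, ENNReal.ofReal ((1 + s i) * b.repr x i ^ 2))
      ^ (1 / 2 : ℝ) ≤ interpNorm A.domain (graphNorm A) (1 / 2) 2 x := by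
  rw [interpNorm_eq]
  refine ENNReal.rpow_le_rpow ?_ (by norm_num)
  calc _ ≤ ∑' i, ENNReal.ofReal (Real.pi / 2 * √(1 + s i ^ 2) * b.repr x i ^ 2) := by
        rw [← ENNReal.tsum_mul_left]
        refine ENNReal.tsum_le_tsum fun i => ?_
        rw [← ENNReal.ofReal_mul (by positivity), ← mul_assoc]
        refine ENNReal.ofReal_le_ofReal (mul_le_mul_of_nonneg_right ?_ (sq_nonneg _))
        nlinarith [mul_le_mul_of_nonneg_left (le_sqrt_one_add_sq (s i)) Real.pi_pos.le]
    _ = _ := (lintegral_minFunctional b s x).symm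
    _ ≤ _ := setLIntegral_mono' measurableSet_Ioi fun t ht =>
        mul_le_mul_right (h.kFunctional_sq_ge ht x) _

lemma interpNorm_le (h : IsDiagonal A b s) (hs : ∀ i, 0 ≤ s i) (x : H) :
    interpNorm A.domain (graphNorm A) (1 / 2) 2 x ≤ (ENNReal.ofReal (3 * Real.pi / 2) *
      ∑' i, ENNReal.ofReal ((1 + s i) * b.repr x i ^ 2)) ^ (1 / 2 : ℝ) := by
  rw [interpNorm_eq]
  refine ENNReal.rpow_le_rpow ?_ (by norm_num)
  calc _ ≤ ∫⁻ t in Ioi (0 : ℝ), 3 * (ENNReal.ofReal (t ^ 2)⁻¹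
          * ENNReal.ofReal (minFunctional b s t x)) :=
        setLIntegral_mono' measurableSet_Ioi fun t ht => by
          rw [mul_left_comm]
          exact mul_le_mul_right (h.kFunctional_sq_le ht x) _
    _ = 3 * ∑' i, ENNReal.ofReal (Real.pi / 2 * √(1 + s i ^ 2) * b.repr x i ^ 2) := by
        rw [lintegral_const_mul' _ _ (by norm_num), lintegral_minFunctional]
    _ ≤ _ := by
        rw [← ENNReal.tsum_mul_left, ← ENNReal.tsum_mul_left]
        refine ENNReal.tsum_le_tsum fun i => ?_
        rw [← ENNReal.ofReal_mul (by positivity), ← mul_assoc,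
          show (3 : ℝ≥0∞) = ENNReal.ofReal 3 by norm_num, ← ENNReal.ofReal_mul (by norm_num)]
        refine ENNReal.ofReal_le_ofReal ?_
        rw [← mul_assoc]
        refine mul_le_mul_of_nonneg_right ?_ (sq_nonneg _)
        nlinarith [mul_le_mul_of_nonneg_left (sqrt_one_add_sq_le (hs i)) Real.pi_pos.le]

/-- For a nonpositive diagonal operator, `[H, D(A)]_{1/2,2}` is the form domain. -/
lemma mem_interpSpace_iff (h : IsDiagonal A b s) (hs : ∀ i, 0 ≤ s i) (x : H) :
    x ∈ interpSpace A.domain (graphNorm A) (1 / 2) 2 ↔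
      Summable fun i => (1 + s i) * b.repr x i ^ 2 := by
  have hnn : ∀ i, 0 ≤ (1 + s i) * b.repr x i ^ 2 := fun i =>
    mul_nonneg (by linarith [hs i]) (sq_nonneg _)
  have hiff : Summable (fun i => (1 + s i) * b.repr x i ^ 2) ↔
      ∑' i, ENNReal.ofReal ((1 + s i) * b.repr x i ^ 2) ≠ ⊤ := by
    refine ⟨fun hsum => hsum.tsum_ofReal_ne_top, fun hne => ?_⟩
    refine (ENNReal.summable_toReal hne).congr fun i => ?_
    rw [ENNReal.toReal_ofReal (hnn i)]
  rw [hiff]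
  refine ⟨fun hx htop => ?_, fun hne => ?_⟩
  · have := (h.interpNorm_ge x).trans_lt hx
    rw [htop, ENNReal.mul_top (by simp [Real.pi_pos]), ENNReal.top_rpow_of_pos (by norm_num)] at this
    exact lt_irrefl _ this
  · exact (h.interpNorm_le hs x).trans_lt (ENNReal.rpow_lt_top_of_nonneg (by norm_num)
      (ENNReal.mul_ne_top ENNReal.ofReal_ne_top hne))

lemma ofReal_mul_sq_rpow_half {c N : ℝ} (hc : 0 ≤ c) (hN : 0 ≤ N) :
    (ENNReal.ofReal c * ENNReal.ofReal (N ^ 2)) ^ (1 / 2 : ℝ) = ENNReal.ofReal (√c * N) := by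
  rw [← ENNReal.ofReal_mul hc, ENNReal.ofReal_rpow_of_nonneg (by positivity) (by norm_num),
    ← Real.sqrt_eq_rpow, Real.sqrt_mul hc, Real.sqrt_sq hN]

lemma interpNorm_equiv (h : IsDiagonal A b s) (hs : ∀ i, 0 ≤ s i) {x : H} {N : ℝ} (hN : 0 ≤ N)
    (hx : HasSum (fun i => (1 + s i) * b.repr x i ^ 2) (N ^ 2)) :
    ENNReal.ofReal (√(Real.pi / 4) * N) ≤ interpNorm A.domain (graphNorm A) (1 / 2) 2 x ∧
    interpNorm A.domain (graphNorm A) (1 / 2) 2 x ≤ ENNReal.ofReal (√(3 * Real.pi / 2) * N) := by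
  have e : ∑' i, ENNReal.ofReal ((1 + s i) * b.repr x i ^ 2) = ENNReal.ofReal (N ^ 2) := by
    rw [← hx.tsum_eq, ENNReal.ofReal_tsum_of_nonneg (fun i =>
      mul_nonneg (by linarith [hs i]) (sq_nonneg _)) hx.summable]
  rw [← ofReal_mul_sq_rpow_half (by positivity) hN, ← ofReal_mul_sq_rpow_half (by positivity) hN,
    ← e]
  exact ⟨h.interpNorm_ge x, h.interpNorm_le hs x⟩

end IsDiagonal

end HeatODE

end

/-! ### Spectral theorem for a compactly embedded form domain -/

noncomputable section

namespace HeatODE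

universe u

/-- A compact self-adjoint operator has a Hilbert basis of eigenvectors. -/
lemma exists_hilbertBasis_eigenvectors {H : Type u} [NormedAddCommGroup H] [InnerProductSpace ℝ H]
    [CompleteSpace H] {T : H →L[ℝ] H} (hc : IsCompactOperator T) (hT : T.IsSymmetric) :
    ∃ (ι : Type u) (b : HilbertBasis ι ℝ H) (r : ι → ℝ), ∀ i, T (b i) = r i • b i := by
  let E : ℝ → Submodule ℝ H := fun c => Module.End.eigenspace (T : Module.End ℝ H) c
  have hE : ∀ c, IsClosed (E c : Set H) := fun c => by
    have : (E c : Set H) = {x | T x = c • x} := by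
      ext x
      exact Module.End.mem_eigenspace_iff
    rw [this]
    exact isClosed_eq T.continuous (continuous_const_smul c)
  have hEc : ∀ c, CompleteSpace (E c) := fun c => (hE c).completeSpace_coe
  -- A Hilbert basis is chosen in every eigenspace, the kernel included; mutual orthogonality of
  -- eigenspaces lets them be united.
  have hb : ∀ c, ∃ (w : Set (E c)) (b : HilbertBasis w ℝ (E c)), ⇑b = ((↑) : w → E c) :=
    fun c => exists_hilbertBasis ℝ (E c)
  choose w bw hbw using hb
  let v : (Σ c, w c) → H := fun i => ((bw i.1 i.2 : E i.1) : H)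
  have hv : Orthonormal ℝ v :=
    hT.orthogonalFamily_eigenspaces.orthonormal_sigma_orthonormal (fun c => (bw c).orthonormal)
  have hsp : (Submodule.span ℝ (range v))ᗮ = ⊥ := by
    rw [eq_bot_iff, ← ContinuousLinearMap.orthogonalComplement_iSup_eigenspaces_eq_bot hc hT]
    intro y hy
    -- A vector orthogonal to all chosen basis vectors is orthogonal to every eigenspace, by
    -- expansion in that eigenspace's basis, hence zero by the spectral theorem.
    suffices hle : ⨆ c, E c ≤ (Submodule.span ℝ {y})ᗮ by
      refine (Submodule.mem_orthogonal _ _).2 fun u hu => ?_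
      rw [real_inner_comm]
      exact Submodule.mem_orthogonal_singleton_iff_inner_right.1 (hle hu)
    refine iSup_le fun c x hx => ?_
    rw [Submodule.mem_orthogonal_singleton_iff_inner_right]
    have h0 : ∀ j : w c, inner ℝ y ((bw c j : E c) : H) = 0 := fun j => by
      rw [real_inner_comm]
      exact (Submodule.mem_orthogonal _ _).1 hy _ (Submodule.subset_span ⟨⟨c, j⟩, rfl⟩)
    have hs := ((bw c).hasSum_repr ⟨x, hx⟩).mapL ((innerSL ℝ y).comp (E c).subtypeL)
    refine hs.unique ?_
    convert hasSum_zero with j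
    simp [h0 j]
  refine ⟨_, HilbertBasis.mkOfOrthogonalEqBot hv hsp, fun i => i.1, fun i => ?_⟩
  rw [HilbertBasis.coe_mkOfOrthogonalEqBot]
  exact Module.End.mem_eigenspace_iff.1 (bw i.1 i.2 : E i.1).2

/-- Let `J : V → H` be a compact dense embedding of norm at most one and let `1 - A` be the operator
associated with the inner product of `V`. Then `A` is diagonal, and the norm of `V` is the form norm
of `1 - A`. -/
lemma exists_isDiagonal {H : Type u} [NormedAddCommGroup H] [InnerProductSpace ℝ H]
    [CompleteSpace H] {V : Type*} [NormedAddCommGroup V] [InnerProductSpace ℝ V] [CompleteSpace V]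
    {J : V →L[ℝ] H} (hc : IsCompactOperator J) (hi : Function.Injective J)
    (hd : ∀ x, (∀ v, inner ℝ (J v) x = 0) → x = 0) (hn : ∀ v, ‖J v‖ ≤ ‖v‖) {A : H →ₗ.[ℝ] H}
    (hA : ∀ x y, (x, y) ∈ A.graph ↔ x = J (J.adjoint (x - y))) :
    ∃ (ι : Type u) (b : HilbertBasis ι ℝ H) (s : ι → ℝ), (∀ i, 0 ≤ s i) ∧
      IsDiagonal A b s ∧
      (∀ v, HasSum (fun i => (1 + s i) * b.repr (J v) i ^ 2) (‖v‖ ^ 2)) ∧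
      ∀ x, Summable (fun i => (1 + s i) * b.repr x i ^ 2) → ∃ v, J v = x := by
  have hsymm : (J.comp J.adjoint).IsSymmetric := fun x y => by
    simp only [ContinuousLinearMap.coe_coe, ContinuousLinearMap.comp_apply]
    rw [← ContinuousLinearMap.adjoint_inner_right, ContinuousLinearMap.adjoint_inner_left]
  obtain ⟨ι, b, r, hb⟩ := exists_hilbertBasis_eigenvectors
    (T := J.comp J.adjoint) (hc.comp_clm J.adjoint) hsymm
  have hb' : ∀ i, J (J.adjoint (b i)) = r i • b i := hb
  have hrn : ∀ i, r i = ‖J.adjoint (b i)‖ ^ 2 := fun i => by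
    rw [← real_inner_self_eq_norm_sq, ContinuousLinearMap.adjoint_inner_left, hb',
      real_inner_smul_right, real_inner_self_eq_norm_sq, b.orthonormal.1 i]
    ring
  -- Density of the range of `J` makes `J*` injective, so no eigenvalue vanishes.
  have hJadj : ∀ i, J.adjoint (b i) ≠ 0 := fun i h0 => by
    refine b.orthonormal.ne_zero i (hd _ fun v => ?_)
    rw [← ContinuousLinearMap.adjoint_inner_right, h0, inner_zero_right]
  have hr0 : ∀ i, 0 < r i := fun i => by
    rw [hrn]
    exact pow_pos (norm_pos_iff.2 (hJadj i)) 2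
  -- Contractivity of `J` gives `r = ‖J J* b‖ ≤ ‖J* b‖ = √r`.
  have hr1 : ∀ i, r i ≤ 1 := fun i => by
    have h1 : r i = ‖J (J.adjoint (b i))‖ := by
      rw [hb', norm_smul, b.orthonormal.1 i, mul_one, Real.norm_of_nonneg (hr0 i).le]
    have h2 := hn (J.adjoint (b i))
    rw [← h1] at h2
    have h3 := hrn i
    have h4 := norm_nonneg (J.adjoint (b i))
    nlinarith [hr0 i]
  have hs1 : ∀ i, 1 + ((r i)⁻¹ - 1) = (r i)⁻¹ := fun i => by ring
  have hreprR : ∀ x i, b.repr (J (J.adjoint x)) i = r i * b.repr x i := fun x i => by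
    rw [b.repr_apply_apply, b.repr_apply_apply, ← ContinuousLinearMap.adjoint_inner_left,
      ContinuousLinearMap.adjoint_inner_right, hb', real_inner_smul_left]
  -- Since `⟨J* b i, J* b j⟩ = ⟨b i, J J* b j⟩ = r j δ i j`, rescaling gives an orthonormal family
  -- in `V`, complete because `J` is injective. Parseval in this basis expresses the norm of `V`
  -- through the coordinates of `J v`.
  have hf : Orthonormal ℝ fun i => (√(r i))⁻¹ • J.adjoint (b i) := by
    classical
    rw [orthonormal_iff_ite]
    intro i j
    rw [real_inner_smul_left, real_inner_smul_right, ContinuousLinearMap.adjoint_inner_left, hb',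
      real_inner_smul_right, orthonormal_iff_ite.1 b.orthonormal]
    split_ifs with hij
    · subst hij
      have := Real.mul_self_sqrt (hr0 i).le
      have h' := (Real.sqrt_pos.2 (hr0 i)).ne'
      field_simp
      linarith
    · simp
  have hfsp : (Submodule.span ℝ (range fun i => (√(r i))⁻¹ • J.adjoint (b i)))ᗮ = ⊥ := by
    rw [eq_bot_iff]
    intro v hv
    rw [Submodule.mem_bot]
    refine hi ?_
    rw [map_zero]
    refine b.ext_repr fun i => ?_
    have h1 := (Submodule.mem_orthogonal _ _).1 hv _ (Submodule.subset_span ⟨i, rfl⟩)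
    simp only at h1
    rw [real_inner_smul_left, ContinuousLinearMap.adjoint_inner_left, ← b.repr_apply_apply] at h1
    rw [map_zero]
    exact (mul_eq_zero.1 h1).resolve_left (inv_ne_zero (Real.sqrt_pos.2 (hr0 i)).ne')
  let f := HilbertBasis.mkOfOrthogonalEqBot hf hfsp
  have hfrepr : ∀ v i, f.repr v i = (√(r i))⁻¹ * b.repr (J v) i := fun v i => by
    rw [f.repr_apply_apply, HilbertBasis.coe_mkOfOrthogonalEqBot, real_inner_smul_left,
      ContinuousLinearMap.adjoint_inner_left, ← b.repr_apply_apply]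
  have hsq : ∀ (i) (c : ℝ), ((√(r i))⁻¹ * c) ^ 2 = (r i)⁻¹ * c ^ 2 := fun i c => by
    rw [mul_pow, inv_pow, Real.sq_sqrt (hr0 i).le]
  -- As `J J* = (1 - A)⁻¹`, its eigenvalue `r` must be `1 / (1 + s)`.
  refine ⟨ι, b, fun i => (r i)⁻¹ - 1, fun i => ?_, fun x y => ?_, fun v => ?_, fun x hx => ?_⟩
  · exact sub_nonneg.2 ((one_le_inv₀ (hr0 i)).2 (hr1 i))
  · rw [hA]
    constructor
    · intro h i
      have h1 := congrArg (fun z => b.repr z i) h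
      simp only at h1
      rw [hreprR, b.repr_sub_apply] at h1
      have := (hr0 i).ne'
      field_simp
      linarith
    · intro h
      refine b.ext_repr fun i => ?_
      rw [hreprR, b.repr_sub_apply, h]
      have := (hr0 i).ne'
      field_simp
      ring
  · refine (f.hasSum_repr_sq v).congr_fun fun i => ?_
    rw [hs1, hfrepr, hsq]
  · obtain ⟨v, hv⟩ := f.exists_repr_eq (a := fun i => (√(r i))⁻¹ * b.repr x i)
      (hx.congr fun i => by rw [hs1, hsq])
    refine ⟨v, b.ext_repr fun i => ?_⟩
    have h1 := hv i
    rw [hfrepr] at h1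
    exact mul_left_cancel₀ (inv_ne_zero (Real.sqrt_pos.2 (hr0 i)).ne') h1

end HeatODE

end

/-! ### Primitives of `L²` functions and compactness of the Volterra operator -/

noncomputable section

namespace HeatODE

section Primitive

variable {L : ℝ}

/-- The primitive `x ↦ c + ∫₀ˣ g` of `g ∈ L²(0, L)`. -/
def prim (c : ℝ) (g : L2 L) (x : ℝ) : ℝ := c + ∫ t in (0 : ℝ)..x, g t

@[simp] lemma prim_zero (c : ℝ) (g : L2 L) : prim c g 0 = c := by simp [prim]

lemma intervalIntegrable_coeFn (hL : 0 < L) (g : L2 L) : IntervalIntegrable g volume 0 L := by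
  rw [intervalIntegrable_iff_integrableOn_Ioo_of_le hL.le]
  exact (Lp.memLp g).integrable (by norm_num)

lemma intervalIntegrable_coeFn_of_mem (hL : 0 < L) (g : L2 L) {x y : ℝ} (hx : x ∈ Icc 0 L)
    (hy : y ∈ Icc 0 L) : IntervalIntegrable g volume x y := by
  refine (intervalIntegrable_coeFn hL g).mono_set ?_
  rw [uIcc_of_le hL.le]
  exact uIcc_subset_Icc hx hy

lemma absolutelyContinuousOnInterval_prim (hL : 0 < L) (c : ℝ) (g : L2 L) :
    AbsolutelyContinuousOnInterval (prim c g) 0 L := by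
  have h := (intervalIntegrable_coeFn hL g).absolutelyContinuousOnInterval_intervalIntegral
    (c := 0) left_mem_uIcc
  have hc : AbsolutelyContinuousOnInterval (fun _ : ℝ => c) 0 L :=
    contDiffOn_const.absolutelyContinuousOnInterval
  exact hc.add h

lemma continuousOn_prim (hL : 0 < L) (c : ℝ) (g : L2 L) : ContinuousOn (prim c g) (Icc 0 L) := by
  have := (absolutelyContinuousOnInterval_prim hL c g).continuousOn
  rwa [uIcc_of_le hL.le] at this

lemma ae_deriv_prim (hL : 0 < L) (c : ℝ) (g : L2 L) :
    ∀ᵐ x, x ∈ uIoc 0 L → deriv (prim c g) x = g x := by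
  filter_upwards [(intervalIntegrable_coeFn hL g).ae_hasDerivAt_integral] with x hx hx'
  exact ((hx (uIoc_subset_uIcc hx') 0 left_mem_uIcc).const_add c).deriv

lemma integral_Ioo_eq (hL : 0 < L) (f : ℝ → ℝ) : ∫ x in Ioo 0 L, f x = ∫ x in (0 : ℝ)..L, f x := by
  rw [intervalIntegral.integral_of_le hL.le, integral_Ioc_eq_integral_Ioo]

/-- Integration by parts against an absolutely continuous function. -/
lemma integral_prim_mul_deriv (hL : 0 < L) (c : ℝ) (g : L2 L) {q q' : ℝ → ℝ}
    (hq : AbsolutelyContinuousOnInterval q 0 L)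
    (hq' : ∀ᵐ x, x ∈ uIoc 0 L → deriv q x = q' x) :
    ∫ x in Ioo 0 L, prim c g x * q' x
      = prim c g L * q L - c * q 0 - ∫ x in Ioo 0 L, g x * q x := by
  rw [integral_Ioo_eq hL, integral_Ioo_eq hL]
  have h := (absolutelyContinuousOnInterval_prim hL c g).integral_mul_deriv_eq_deriv_mul hq
  rw [prim_zero] at h
  convert h using 1
  · refine intervalIntegral.integral_congr_ae ?_
    filter_upwards [hq'] with x hx hx'
    rw [hx hx']
  · congr 1
    refine intervalIntegral.integral_congr_ae ?_
    filter_upwards [ae_deriv_prim hL c g] with x hx hx'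
    rw [hx hx']

lemma integral_prim_mul (hL : 0 < L) (c d : ℝ) (g h : L2 L) :
    ∫ x in Ioo 0 L, prim c g x * h x
      = prim c g L * prim d h L - c * d - ∫ x in Ioo 0 L, g x * prim d h x := by
  rw [integral_prim_mul_deriv hL c g (absolutelyContinuousOnInterval_prim hL d h)
    (ae_deriv_prim hL d h), prim_zero]

/-- Cauchy–Schwarz: the increment is the inner product of `g` with the indicator of `(x, y)`, of
norm `√(y - x)`. -/
lemma abs_prim_sub_le (hL : 0 < L) (c : ℝ) (g : L2 L) {x y : ℝ} (hx : x ∈ Icc 0 L)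
    (hy : y ∈ Icc 0 L) (hxy : x ≤ y) :
    |prim c g y - prim c g x| ≤ √(y - x) * ‖g‖ := by
  have h0 : (0 : ℝ) ∈ Icc 0 L := left_mem_Icc.2 hL.le
  have e : prim c g y - prim c g x = inner ℝ (indicatorConstLp 2
      (μ := volume.restrict (Ioo 0 L)) (measurableSet_Ioo (a := x) (b := y))
      (measure_ne_top _ _) (1 : ℝ)) g := by
    rw [L2.inner_indicatorConstLp_one, Measure.restrict_restrict measurableSet_Ioo,
      inter_eq_left.2 (Ioo_subset_Ioo hx.1 hy.2), prim, prim, add_sub_add_left_eq_sub,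
      intervalIntegral.integral_interval_sub_left (intervalIntegrable_coeFn_of_mem hL g h0 hy)
        (intervalIntegrable_coeFn_of_mem hL g h0 hx),
      intervalIntegral.integral_of_le hxy, integral_Ioc_eq_integral_Ioo]
  rw [e]
  refine (abs_real_inner_le_norm _ _).trans (mul_le_mul_of_nonneg_right ?_ (norm_nonneg _))
  rw [norm_indicatorConstLp (by norm_num) (by norm_num), Real.sqrt_eq_rpow, measureReal_def,
    Measure.restrict_apply measurableSet_Ioo, inter_eq_left.2 (Ioo_subset_Ioo hx.1 hy.2),
    Real.volume_Ioo, ENNReal.toReal_ofReal (sub_nonneg.2 hxy)]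
  norm_num

lemma memLp_of_continuousOn {u : ℝ → ℝ} (hu : ContinuousOn u (Icc 0 L)) :
    MemLp u 2 (volume.restrict (Ioo 0 L)) := by
  obtain ⟨C, hC⟩ := isCompact_Icc.exists_bound_of_continuousOn hu
  refine MemLp.of_bound ((hu.mono Ioo_subset_Icc_self).aestronglyMeasurable measurableSet_Ioo) C ?_
  exact (ae_restrict_iff' measurableSet_Ioo).2
    (Eventually.of_forall fun x hx => hC x (Ioo_subset_Icc_self hx))

lemma prim_add (hL : 0 < L) (c d : ℝ) (g h : L2 L) {x : ℝ} (hx : x ∈ Icc 0 L) :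
    prim (c + d) (g + h) x = prim c g x + prim d h x := by
  have h0 : (0 : ℝ) ∈ Icc 0 L := left_mem_Icc.2 hL.le
  have e : ∫ t in (0 : ℝ)..x, (g + h : L2 L) t = ∫ t in (0 : ℝ)..x, (g t + h t) := by
    refine intervalIntegral.integral_congr_ae_restrict ?_
    rw [uIoc_of_le hx.1, ← restrict_Ioo_eq_restrict_Ioc]
    exact ae_restrict_of_ae_restrict_of_subset (Ioo_subset_Ioo_right hx.2) (Lp.coeFn_add g h)
  rw [prim, prim, prim, e, intervalIntegral.integral_add
    (intervalIntegrable_coeFn_of_mem hL g h0 hx) (intervalIntegrable_coeFn_of_mem hL h h0 hx)]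
  ring

lemma prim_smul (r c : ℝ) (g : L2 L) {x : ℝ} (hx : x ∈ Icc 0 L) :
    prim (r * c) (r • g) x = r * prim c g x := by
  have e : ∫ t in (0 : ℝ)..x, (r • g : L2 L) t = ∫ t in (0 : ℝ)..x, r * g t := by
    refine intervalIntegral.integral_congr_ae_restrict ?_
    rw [uIoc_of_le hx.1, ← restrict_Ioo_eq_restrict_Ioc]
    exact ae_restrict_of_ae_restrict_of_subset (Ioo_subset_Ioo_right hx.2) (Lp.coeFn_smul r g)
  rw [prim, prim, e, intervalIntegral.integral_const_mul]
  ring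

lemma norm_le_of_bound_Ioo (hL : 0 < L) {f : L2 L} {C : ℝ} (hC : 0 ≤ C)
    (h : ∀ᵐ x ∂(volume.restrict (Ioo 0 L)), |f x| ≤ C) : ‖f‖ ≤ √L * C := by
  refine (Lp.norm_le_of_ae_bound hC h).trans (mul_le_mul_of_nonneg_right (le_of_eq ?_) hC)
  rw [Real.sqrt_eq_rpow, measureUnivNNReal, Measure.restrict_apply_univ, Real.volume_Ioo, sub_zero,
    ENNReal.toReal_ofNat, one_div, ENNReal.ofReal, ENNReal.toNNReal_coe]
  rw [Real.coe_toNNReal _ hL.le]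

/-- Evaluation of the primitive at a point is a bounded functional, so each summand of
`volterraStep` has rank at most one. -/
lemma inner_indicator_Iio (g : L2 L) {x : ℝ} (hx : x ∈ Icc 0 L) :
    inner ℝ (indicatorConstLp 2 (μ := volume.restrict (Ioo 0 L))
      (measurableSet_Iio (a := x)) (measure_ne_top _ _) (1 : ℝ)) g = prim 0 g x := by
  have : Iio x ∩ Ioo 0 L = Ioo 0 x := by
    ext t
    simp only [mem_inter_iff, mem_Iio, mem_Ioo]
    exact ⟨fun h => ⟨h.2.1, h.1⟩, fun h => ⟨h.2, h.1, h.2.trans_le hx.2⟩⟩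
  rw [L2.inner_indicatorConstLp_one, Measure.restrict_restrict measurableSet_Iio, this, prim,
    intervalIntegral.integral_of_le hx.1, integral_Ioc_eq_integral_Ioo, zero_add]

/-- The step function with the values of `∫₀ˣ g` at the left ends of `n` equal intervals. -/
def volterraStep (L : ℝ) (n : ℕ) : L2 L →L[ℝ] L2 L :=
  ∑ k ∈ Finset.range n, (ContinuousLinearMap.toSpanSingleton ℝ
    (indicatorConstLp 2 (μ := volume.restrict (Ioo 0 L))
      (measurableSet_Ico (a := k * (L / n)) (b := (k + 1) * (L / n))) (measure_ne_top _ _)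
        (1 : ℝ))).comp
    (innerSL ℝ (indicatorConstLp 2 (μ := volume.restrict (Ioo 0 L))
      (measurableSet_Iio (a := k * (L / n))) (measure_ne_top _ _) (1 : ℝ)))

lemma isCompactOperator_volterraStep (n : ℕ) : IsCompactOperator (volterraStep L n) := by
  have : volterraStep L n ∈ compactOperator (RingHom.id ℝ) (L2 L) (L2 L) :=
    Submodule.sum_mem _ fun k _ => by
      have h := isCompactOperator_of_locallyCompactSpace_rng
        (ContinuousLinearMap.toSpanSingleton ℝ
          (indicatorConstLp 2 (μ := volume.restrict (Ioo 0 L))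
            (measurableSet_Ico (a := k * (L / n)) (b := (k + 1) * (L / n))) (measure_ne_top _ _)
            (1 : ℝ)))
      exact h.comp_clm _
  exact this

end Primitive

section Volterra

variable {L : ℝ} [hL : Fact (0 < L)]

/-- The Volterra operator `(V g)(x) = ∫₀ˣ g` on `L²(0, L)`. -/
def volterra (L : ℝ) [hL : Fact (0 < L)] : L2 L →L[ℝ] L2 L :=
  LinearMap.mkContinuousOfExistsBound
    { toFun := fun g => (memLp_of_continuousOn (continuousOn_prim hL.out 0 g)).toLp _
      map_add' := fun g h => by
        rw [← MemLp.toLp_add]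
        refine MemLp.toLp_congr _ _ ((ae_restrict_iff' measurableSet_Ioo).2
          (Eventually.of_forall fun x hx => ?_))
        have := prim_add hL.out 0 0 g h (Ioo_subset_Icc_self hx)
        rwa [add_zero] at this
      map_smul' := fun r g => by
        rw [RingHom.id_apply, ← MemLp.toLp_const_smul]
        refine MemLp.toLp_congr _ _ ((ae_restrict_iff' measurableSet_Ioo).2
          (Eventually.of_forall fun x hx => ?_))
        have := prim_smul r 0 g (Ioo_subset_Icc_self hx)
        rwa [mul_zero] at this }
    -- One factor bounds the supremum of the primitive by `√L ‖g‖`, the other passes from the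
    -- supremum to the `L²` norm.
    ⟨√L * √L, fun g => by
      rw [mul_assoc]
      refine norm_le_of_bound_Ioo hL.out (by positivity) ?_
      filter_upwards [(memLp_of_continuousOn (continuousOn_prim hL.out 0 g)).coeFn_toLp,
        ae_restrict_mem measurableSet_Ioo] with x hx hx'
      simp only [LinearMap.coe_mk, AddHom.coe_mk]
      rw [hx]
      have h := abs_prim_sub_le hL.out 0 g (left_mem_Icc.2 hL.out.le) (Ioo_subset_Icc_self hx')
        hx'.1.le
      rw [prim_zero, sub_zero, sub_zero] at h
      exact h.trans (mul_le_mul_of_nonneg_right (Real.sqrt_le_sqrt hx'.2.le) (norm_nonneg _))⟩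

lemma coeFn_volterra (g : L2 L) : volterra L g =ᵐ[volume.restrict (Ioo 0 L)] prim 0 g :=
  (memLp_of_continuousOn (continuousOn_prim hL.out 0 g)).coeFn_toLp

lemma coeFn_volterraStep (n : ℕ) (g : L2 L) :
    volterraStep L n g =ᵐ[volume.restrict (Ioo 0 L)] fun x => ∑ k ∈ Finset.range n,
      prim 0 g (k * (L / n)) * (Ico (k * (L / n)) ((k + 1) * (L / n))).indicator 1 x := by
  have h1 : volterraStep L n g = ∑ k ∈ Finset.range n, prim 0 g (k * (L / n)) •
      indicatorConstLp 2 (μ := volume.restrict (Ioo 0 L))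
      (measurableSet_Ico (a := k * (L / n)) (b := (k + 1) * (L / n))) (measure_ne_top _ _)
        (1 : ℝ) := by
    rw [volterraStep, _root_.sum_apply]
    refine Finset.sum_congr rfl fun k hk => ?_
    have hn : (0 : ℝ) < n := by
      exact_mod_cast (Nat.zero_le k).trans_lt (Finset.mem_range.1 hk)
    have hk' : (k : ℝ) ≤ n := by exact_mod_cast (Finset.mem_range.1 hk).le
    have hL' := hL.out
    rw [ContinuousLinearMap.comp_apply, ContinuousLinearMap.toSpanSingleton_apply,
      innerSL_apply_apply, inner_indicator_Iio g ⟨by positivity, ?_⟩]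
    rw [← mul_div_assoc, div_le_iff₀ hn]
    nlinarith
  rw [h1]
  refine (Lp.coeFn_finsetSum _ _).trans ?_
  have h2 : ∀ k : ℕ, _ := fun k => (Lp.coeFn_smul (prim 0 g (k * (L / n)))
    (indicatorConstLp 2 (μ := volume.restrict (Ioo 0 L))
      (measurableSet_Ico (a := k * (L / n)) (b := (k + 1) * (L / n))) (measure_ne_top _ _)
        (1 : ℝ))).trans (indicatorConstLp_coeFn.const_smul _)
  filter_upwards [ae_all_iff.2 h2] with x hx
  rw [Finset.sum_apply]
  refine Finset.sum_congr rfl fun k _ => ?_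
  rw [hx k]
  rfl

/-- A point lies within `L / n` of the left end of its interval, so the Hölder bound of
`abs_prim_sub_le` controls the pointwise error by `√(L / n) ‖g‖`. Hence the Volterra operator is a
norm limit of finite-rank operators. -/
lemma norm_volterra_sub_volterraStep_le {n : ℕ} (hn : 0 < n) :
    ‖volterra L - volterraStep L n‖ ≤ √L * √(L / n) := by
  have hL' := hL.out
  have hn' : (0 : ℝ) < n := by exact_mod_cast hn
  have hh : 0 < L / n := by positivity
  refine ContinuousLinearMap.opNorm_le_bound _ (by positivity) fun g => ?_
  rw [mul_assoc]
  refine norm_le_of_bound_Ioo hL' (by positivity) ?_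
  filter_upwards [coeFn_volterra g, coeFn_volterraStep n g, ae_restrict_mem measurableSet_Ioo,
    Lp.coeFn_sub (volterra L g) (volterraStep L n g)] with x h1 h2 hx h3
  rw [_root_.sub_apply, h3, Pi.sub_apply, h1, h2]
  have hx0 : 0 ≤ x / (L / n) := div_nonneg hx.1.le hh.le
  -- The index of the only interval containing `x`; `k < n` because `x < L`.
  set k := ⌊x / (L / n)⌋₊ with hk
  have hk1 : k * (L / n) ≤ x := (le_div_iff₀ hh).1 (Nat.floor_le hx0)
  have hk2 : x < (k + 1) * (L / n) := (div_lt_iff₀ hh).1 (Nat.lt_floor_add_one _)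
  have hkn : k < n := by
    rw [hk, Nat.floor_lt hx0, div_lt_iff₀ hh, mul_div_cancel₀ _ hn'.ne']
    exact hx.2
  rw [Finset.sum_eq_single_of_mem k (Finset.mem_range.2 hkn)]
  · rw [indicator_of_mem (show x ∈ Ico _ _ from ⟨hk1, hk2⟩), Pi.one_apply, mul_one]
    refine (abs_prim_sub_le hL' 0 g ⟨by positivity, hk1.trans hx.2.le⟩ (Ioo_subset_Icc_self hx)
      hk1).trans (mul_le_mul_of_nonneg_right (Real.sqrt_le_sqrt ?_) (norm_nonneg _))
    linarith
  · intro j _ hjk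
    rw [indicator_of_notMem, mul_zero]
    rintro ⟨h4, h5⟩
    refine hjk ?_
    rw [hk, eq_comm, Nat.floor_eq_iff hx0, le_div_iff₀ hh, div_lt_iff₀ hh]
    exact ⟨h4, h5⟩

lemma isCompactOperator_volterra : IsCompactOperator (volterra L) := by
  refine isCompactOperator_of_tendsto (l := atTop) (F := volterraStep L) ?_
    (Eventually.of_forall isCompactOperator_volterraStep)
  rw [tendsto_iff_norm_sub_tendsto_zero]
  have h : Tendsto (fun n : ℕ => √L * √(L / n)) atTop (𝓝 0) := by
    simpa using ((Real.continuous_sqrt.tendsto 0).comp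
      (tendsto_const_div_atTop_nhds_zero_nat L)).const_mul (√L)
  refine squeeze_zero' (Eventually.of_forall fun n => norm_nonneg _) ?_ h
  filter_upwards [eventually_gt_atTop 0] with n hn
  rw [norm_sub_rev]
  exact norm_volterra_sub_volterraStep_le hn

end Volterra

end HeatODE

end

/-! ### Weak derivatives on an interval: `H¹` functions are primitives -/

noncomputable section

namespace HeatODE

section WeakDerivative

variable {L : ℝ}

lemma integral_coeFn_zero_mul (ψ : ℝ → ℝ) : ∫ x in Ioo 0 L, (0 : L2 L) x * ψ x = 0 := by
  refine integral_eq_zero_of_ae ?_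
  filter_upwards [Lp.coeFn_zero ℝ 2 (volume.restrict (Ioo 0 L))] with x hx
  simp only [hx, Pi.zero_apply, zero_mul]

/-- The hypothesis says that `f` is a weak derivative of `0`, so uniqueness of weak derivatives
applies. -/
lemma eq_zero_of_forall_integral_mul_test {f : L2 L}
    (h : ∀ φ : ℝ → ℝ, ContDiff ℝ (⊤ : ℕ∞) φ → HasCompactSupport φ → tsupport φ ⊆ Ioo 0 L →
      ∫ x in Ioo 0 L, f x * φ x = 0) : f = 0 := by
  refine IsWeakDeriv.unique (y := 0) (fun φ h1 h2 h3 => ?_) IsWeakDeriv.zero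
  rw [integral_coeFn_zero_mul, h φ h1 h2 h3, neg_zero]

lemma integral_Ioo_eq_integral {φ : ℝ → ℝ} (hφ : tsupport φ ⊆ Ioo 0 L) :
    ∫ x in Ioo 0 L, φ x = ∫ x, φ x :=
  setIntegral_eq_integral_of_forall_compl_eq_zero fun x hx => by
    by_contra hne
    exact hx (hφ (subset_tsupport _ hne))

/-- A test function with vanishing integral is the derivative of a test function. -/
lemma exists_test_deriv_eq {φ : ℝ → ℝ} (h1 : ContDiff ℝ (⊤ : ℕ∞) φ) (h2 : HasCompactSupport φ)
    (h3 : tsupport φ ⊆ Ioo 0 L) (hne : (tsupport φ).Nonempty) (h0 : ∫ x, φ x = 0) :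
    ∃ Φ : ℝ → ℝ, ContDiff ℝ (⊤ : ℕ∞) Φ ∧ HasCompactSupport Φ ∧ tsupport Φ ⊆ Ioo 0 L ∧
      deriv Φ = φ := by
  obtain ⟨a, ha, ha'⟩ := h2.isCompact.exists_isLeast hne
  obtain ⟨b, hb, hb'⟩ := h2.isCompact.exists_isGreatest hne
  have haL := h3 ha
  have hbL := h3 hb
  have hsupp : ∀ x, φ x ≠ 0 → a ≤ x ∧ x ≤ b := fun x hx =>
    ⟨ha' (subset_tsupport _ hx), hb' (subset_tsupport _ hx)⟩
  have hd : ∀ x, HasDerivAt (fun x => ∫ t in (0 : ℝ)..x, φ t) (φ x) x := fun x =>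
    h1.continuous.integral_hasStrictDerivAt 0 x |>.hasDerivAt
  have hderiv : deriv (fun x => ∫ t in (0 : ℝ)..x, φ t) = φ := funext fun x => (hd x).deriv
  -- To the left of the support the primitive vanishes trivially; to the right it equals the total
  -- integral, which is zero.
  have hzero : ∀ x ∉ Icc a b, ∫ t in (0 : ℝ)..x, φ t = 0 := by
    intro x hx
    rcases lt_or_ge x a with hxa | hxa
    · refine intervalIntegral.integral_zero_ae (Eventually.of_forall fun t ht => ?_)
      by_contra hne
      have := (hsupp t hne).1
      rcases le_max_iff.1 ht.2 with h | h
      · linarith [haL.1]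
      · linarith
    · have hxb : b < x := by
        by_contra hle
        exact hx ⟨hxa, not_lt.1 hle⟩
      rw [intervalIntegral.integral_eq_integral_of_support_subset, h0]
      exact fun t ht => ⟨haL.1.trans_le (hsupp t ht).1, (hsupp t ht).2.trans hxb.le⟩
  have hts : tsupport (fun x => ∫ t in (0 : ℝ)..x, φ t) ⊆ Icc a b := by
    refine isClosed_Icc.closure_subset_iff.2 fun x hx => ?_
    by_contra hx'
    exact hx (hzero x hx')
  refine ⟨_, ?_, HasCompactSupport.intro isCompact_Icc hzero,
    hts.trans (Icc_subset_Ioo haL.1 hbL.2), hderiv⟩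
  rw [contDiff_infty_iff_deriv, hderiv]
  exact ⟨fun x => (hd x).differentiableAt, h1⟩

lemma exists_test_integral_eq_one (hL : 0 < L) : ∃ ψ : ℝ → ℝ, ContDiff ℝ (⊤ : ℕ∞) ψ ∧
    HasCompactSupport ψ ∧ tsupport ψ ⊆ Ioo 0 L ∧ ∫ x, ψ x = 1 := by
  let f : ContDiffBump (L / 2) := ⟨L / 8, L / 4, by positivity, by linarith⟩
  refine ⟨f.normed volume, f.contDiff_normed, f.hasCompactSupport_normed, ?_, f.integral_normed⟩
  rw [f.tsupport_normed_eq, Real.closedBall_eq_Icc]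
  exact Icc_subset_Ioo (by change 0 < L / 2 - L / 4; linarith)
    (by change L / 2 + L / 4 < L; linarith)

/-- The lemma of du Bois-Reymond. -/
lemma exists_ae_eq_const_of_isWeakDeriv_zero (hL : 0 < L) {w : L2 L} (hw : IsWeakDeriv w 0) :
    ∃ c : ℝ, w = Lp.const 2 (volume.restrict (Ioo 0 L)) c := by
  obtain ⟨ψ, hψ1, hψ2, hψ3, hψ⟩ := exists_test_integral_eq_one hL
  -- If `w` is constant, this is its value, as `∫ ψ = 1`. In general `φ - (∫ φ) ψ` has zero mean and
  -- is the derivative of a test function, so `w` annihilates it and `∫ w φ = c ∫ φ`.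
  set c := ∫ x in Ioo 0 L, w x * ψ x with hc
  refine ⟨c, ?_⟩
  rw [← sub_eq_zero]
  refine eq_zero_of_forall_integral_mul_test fun φ h1 h2 h3 => ?_
  set r := ∫ x, φ x with hr
  have hsub : ∀ (y : L2 L), ∫ x in Ioo 0 L, y x * (φ x - r * ψ x)
      = (∫ x in Ioo 0 L, y x * φ x) - r * ∫ x in Ioo 0 L, y x * ψ x := fun y => by
    rw [← integral_const_mul, ← integral_sub (integrable_mul y h1.continuous h2)
      ((integrable_mul y hψ1.continuous hψ2).const_mul r)]
    congr 1
    funext x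
    ring
  have hφψ : ∫ x in Ioo 0 L, w x * (φ x - r * ψ x) = 0 := by
    -- The function may vanish identically, leaving no end points of the support from which to build
    -- its primitive.
    by_cases hne : (tsupport fun x => φ x - r * ψ x).Nonempty
    · have hts : tsupport (fun x => φ x - r * ψ x) ⊆ Ioo 0 L := by
        refine (tsupport_sub φ fun x => r * ψ x).trans (union_subset h3 ?_)
        exact (tsupport_mul_subset_right (f := fun _ => r)).trans hψ3
      have hcs : HasCompactSupport fun x => φ x - r * ψ x := h2.sub hψ2.mul_left
      obtain ⟨Φ, hΦ1, hΦ2, hΦ3, hΦ⟩ := exists_test_deriv_eq (h1.sub (contDiff_const.mul hψ1))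
        hcs hts hne (by
          rw [integral_sub (h1.continuous.integrable_of_hasCompactSupport h2)
            ((hψ1.continuous.integrable_of_hasCompactSupport hψ2).const_mul r),
            integral_const_mul, hψ, mul_one, sub_self])
      have := hw Φ hΦ1 hΦ2 hΦ3
      rw [hΦ] at this
      rw [this, integral_coeFn_zero_mul, neg_zero]
    · rw [not_nonempty_iff_eq_empty, tsupport_eq_empty_iff] at hne
      simp_rw [show ∀ x, φ x - r * ψ x = 0 from fun x => congrFun hne x]
      simp
  have e : ∫ x in Ioo 0 L, (w - Lp.const 2 (volume.restrict (Ioo 0 L)) c : L2 L) x * φ x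
      = ∫ x in Ioo 0 L, (w x * φ x - c * φ x) := by
    refine integral_congr_ae ?_
    filter_upwards [Lp.coeFn_sub w (Lp.const 2 (volume.restrict (Ioo 0 L)) c),
      Lp.coeFn_const 2 (volume.restrict (Ioo 0 L)) c] with x hx hx'
    rw [hx, Pi.sub_apply, hx', Function.const_apply, sub_mul]
  rw [hsub, sub_eq_zero] at hφψ
  rw [e, integral_sub (integrable_mul w h1.continuous h2)
    ((h1.continuous.integrable_of_hasCompactSupport h2).integrableOn.const_mul c),
    integral_const_mul, integral_Ioo_eq_integral h3, hφψ, hc]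
  ring

lemma isWeakDeriv_of_ae_eq_prim (hL : 0 < L) {y g : L2 L} {c : ℝ}
    (h : y =ᵐ[volume.restrict (Ioo 0 L)] prim c g) : IsWeakDeriv y g := by
  intro φ h1 h2 h3
  have hout : ∀ x ∉ Ioo 0 L, φ x = 0 := fun x hx => by
    by_contra hne
    exact hx (h3 (subset_tsupport _ hne))
  have hac : AbsolutelyContinuousOnInterval φ 0 L :=
    (h1.of_le (by simp)).contDiffOn.absolutelyContinuousOnInterval
  have e := integral_prim_mul_deriv hL c g hac (q' := deriv φ)
    (Eventually.of_forall fun x _ => rfl)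
  rw [hout 0 (by simp), hout L (by simp)] at e
  rw [mul_zero, mul_zero, sub_zero, zero_sub] at e
  rw [← e]
  refine integral_congr_ae ?_
  filter_upwards [h] with x hx
  rw [hx]

lemma hasBoundaryValue_of_ae_eq_prim (hL : 0 < L) {y g : L2 L} {c : ℝ}
    (h : y =ᵐ[volume.restrict (Ioo 0 L)] prim c g) (a : ℝ) :
    HasBoundaryValue y a (prim c g a) :=
  ⟨prim c g, continuousOn_prim hL c g, h.symm, rfl⟩

variable [hL : Fact (0 < L)]

lemma coeFn_const_add_volterra (c : ℝ) (g : L2 L) :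
    (Lp.const 2 (volume.restrict (Ioo 0 L)) c + volterra L g : L2 L)
      =ᵐ[volume.restrict (Ioo 0 L)] prim c g := by
  filter_upwards [Lp.coeFn_add (Lp.const 2 (volume.restrict (Ioo 0 L)) c) (volterra L g),
    Lp.coeFn_const 2 (volume.restrict (Ioo 0 L)) c, coeFn_volterra g] with x h1 h2 h3
  rw [h1, Pi.add_apply, h2, h3, prim, prim, Function.const_apply, zero_add]

lemma eq_const_add_volterra_iff {y g : L2 L} {c : ℝ} :
    y = Lp.const 2 (volume.restrict (Ioo 0 L)) c + volterra L g ↔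
      y =ᵐ[volume.restrict (Ioo 0 L)] prim c g := by
  rw [Lp.ext_iff]
  exact ⟨fun h => h.trans (coeFn_const_add_volterra c g),
    fun h => h.trans (coeFn_const_add_volterra c g).symm⟩

/-- The difference of `y` and the Volterra primitive of `g` has zero weak derivative, hence is
constant. -/
lemma IsWeakDeriv.exists_ae_eq_prim {y g : L2 L} (h : IsWeakDeriv y g) :
    ∃ c, y =ᵐ[volume.restrict (Ioo 0 L)] prim c g := by
  have hV : IsWeakDeriv (volterra L g) g := isWeakDeriv_of_ae_eq_prim hL.out (coeFn_volterra g)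
  have h0 : IsWeakDeriv (y + (-1 : ℝ) • volterra L g) 0 := by
    have := h.add (hV.smul (-1))
    rwa [neg_one_smul ℝ g, add_neg_cancel] at this
  obtain ⟨c, hc⟩ := exists_ae_eq_const_of_isWeakDeriv_zero hL.out h0
  refine ⟨c, eq_const_add_volterra_iff.1 ?_⟩
  rw [← hc, neg_one_smul, neg_add_cancel_right]

lemma IsWeakDeriv.ae_eq_prim {y g : L2 L} {c : ℝ} (h : IsWeakDeriv y g)
    (hc : HasBoundaryValue y 0 c) : y =ᵐ[volume.restrict (Ioo 0 L)] prim c g := by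
  obtain ⟨d, hd⟩ := h.exists_ae_eq_prim
  have := hc.unique hL.out (left_mem_Icc.2 hL.out.le) (hasBoundaryValue_of_ae_eq_prim hL.out hd 0)
  rw [prim_zero] at this
  rwa [this]

end WeakDerivative

end HeatODE

end

/-! ### The form space `ℋ¹` and the resolvent of `𝒜` -/

noncomputable section

namespace HeatODE

variable {L μ κ : ℝ}

lemma norm_sq_eq_integral (g : L2 L) : ‖g‖ ^ 2 = ∫ x in Ioo 0 L, g x ^ 2 := by
  rw [← real_inner_self_eq_norm_sq, L2.inner_def]
  simp [sq]

lemma inner_eq_integral (g h : L2 L) : inner ℝ g h = ∫ x in Ioo 0 L, g x * h x := by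
  rw [L2.inner_def]
  simp [mul_comm]

namespace StateSpace

lemma ext {U V : StateSpace L μ κ} (h₁ : U.heat = V.heat) (h₂ : U.ode = V.ode) : U = V :=
  WithLp.ofLp_injective 2 (Prod.ext h₁ h₂)

end StateSpace

variable [hμκ : Fact (0 < μ * κ)]

namespace StateSpace

/-- The first component as a continuous linear map. -/
def heatL (L μ κ : ℝ) [Fact (0 < μ * κ)] : StateSpace L μ κ →L[ℝ] L2 L :=
  WithLp.fstL 2 ℝ (L2 L) (WeightedLine μ κ)

/-- The second component as a continuous linear map. -/
def odeL (L μ κ : ℝ) [Fact (0 < μ * κ)] : StateSpace L μ κ →L[ℝ] ℝ :=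
  (LinearMap.toContinuousLinearMap (WeightedLine.toReal (μ := μ) (κ := κ)).toLinearMap).comp
    (WithLp.sndL 2 ℝ (L2 L) (WeightedLine μ κ))

/-- The map `y ↦ (y, 0)`. -/
def inlL (L μ κ : ℝ) [Fact (0 < μ * κ)] : L2 L →L[ℝ] StateSpace L μ κ :=
  (WithLp.prodContinuousLinearEquiv 2 ℝ (L2 L) (WeightedLine μ κ)).symm.toContinuousLinearMap.comp
    (ContinuousLinearMap.inl ℝ (L2 L) (WeightedLine μ κ))

end StateSpace

variable [hL : Fact (0 < L)]

/-- The Hilbert space `ℋ¹`, as the closed space of the couples `(U, y')`, `U = (y, α) ∈ ℋ¹`. -/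
def formSpace (L μ κ : ℝ) [Fact (0 < μ * κ)] [Fact (0 < L)] :
    Submodule ℝ (WithLp 2 (StateSpace L μ κ × L2 L)) :=
  LinearMap.eqLocus
    ((StateSpace.heatL L μ κ).comp (WithLp.fstL 2 ℝ (StateSpace L μ κ) (L2 L))).toLinearMap
    (((Lp.constL 2 (volume.restrict (Ioo 0 L)) ℝ).comp
      (μ • (StateSpace.odeL L μ κ).comp (WithLp.fstL 2 ℝ (StateSpace L μ κ) (L2 L))))
      + (volterra L).comp (WithLp.sndL 2 ℝ (StateSpace L μ κ) (L2 L))).toLinearMap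

/-- The single equation `y = μ α + ∫₀ˣ g` encodes both `y' = g` and `y(0) = μ α`, and it equates two
continuous maps. -/
lemma isClosed_formSpace :
    IsClosed (formSpace L μ κ : Set (WithLp 2 (StateSpace L μ κ × L2 L))) :=
  isClosed_eq (ContinuousLinearMap.continuous _) (ContinuousLinearMap.continuous _)

instance : CompleteSpace (formSpace L μ κ) := isClosed_formSpace.completeSpace_coe

lemma mem_formSpace_iff_eq {w : WithLp 2 (StateSpace L μ κ × L2 L)} : w ∈ formSpace L μ κ ↔
    w.fst.heat = Lp.const 2 (volume.restrict (Ioo 0 L)) (μ * w.fst.ode) + volterra L w.snd :=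
  Iff.rfl

lemma mem_formSpace_iff {w : WithLp 2 (StateSpace L μ κ × L2 L)} : w ∈ formSpace L μ κ ↔
    w.fst.heat =ᵐ[volume.restrict (Ioo 0 L)] prim (μ * w.fst.ode) w.snd :=
  mem_formSpace_iff_eq.trans eq_const_add_volterra_iff

/-- The embedding of `ℋ¹` into `ℋ`. -/
def embed (L μ κ : ℝ) [Fact (0 < μ * κ)] [Fact (0 < L)] : formSpace L μ κ →L[ℝ] StateSpace L μ κ :=
  (WithLp.fstL 2 ℝ (StateSpace L μ κ) (L2 L)).comp (formSpace L μ κ).subtypeL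

lemma embed_apply (v : formSpace L μ κ) : embed L μ κ v = v.1.fst := rfl

/-- The Hilbert space adjoint of the embedding of `ℋ¹` into `ℋ`. -/
abbrev embedAdjoint (L μ κ : ℝ) [Fact (0 < μ * κ)] [Fact (0 < L)] :
    StateSpace L μ κ →L[ℝ] formSpace L μ κ :=
  ContinuousLinearMap.adjoint (𝕜 := ℝ) (E := formSpace L μ κ) (F := StateSpace L μ κ)
    (embed L μ κ)

lemma isWeakDeriv_snd (v : formSpace L μ κ) : IsWeakDeriv v.1.fst.heat v.1.snd :=
  isWeakDeriv_of_ae_eq_prim hL.out (mem_formSpace_iff.1 v.2)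

lemma inner_formSpace (v w : formSpace L μ κ) :
    inner ℝ v w = inner ℝ v.1.fst w.1.fst + inner ℝ v.1.snd w.1.snd :=
  WithLp.prod_inner_apply v.1 w.1

lemma norm_sq_formSpace (v : formSpace L μ κ) : ‖v‖ ^ 2 = ‖v.1.fst‖ ^ 2 + ‖v.1.snd‖ ^ 2 :=
  WithLp.prod_norm_sq_eq_of_L2 v.1

lemma norm_embed_le (v : formSpace L μ κ) : ‖embed L μ κ v‖ ≤ ‖v‖ := by
  refine le_of_sq_le_sq ?_ (norm_nonneg _)
  rw [norm_sq_formSpace, embed_apply]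
  exact le_add_of_nonneg_right (sq_nonneg _)

lemma injective_embed : Function.Injective (embed L μ κ) := by
  intro v w h
  have h' : v.1.fst = w.1.fst := h
  have hv := isWeakDeriv_snd v
  rw [h'] at hv
  exact Subtype.ext (WithLp.ofLp_injective 2 (Prod.ext h' (hv.unique (isWeakDeriv_snd w))))

/-- The map `α ↦ (μ α, α)`. -/
def constState (L μ κ : ℝ) [Fact (0 < μ * κ)] : ℝ →L[ℝ] StateSpace L μ κ :=
  LinearMap.toContinuousLinearMap
    (LinearMap.toSpanSingleton ℝ _
      (StateSpace.mk (Lp.const 2 (volume.restrict (Ioo 0 L)) μ) 1))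

/-- On the form space `(y, α) = (∫₀ˣ y', 0) + α (μ, 1)`: the first term factors through the compact
Volterra operator, the second through `ℝ`. -/
lemma isCompactOperator_embed : IsCompactOperator (embed L μ κ) := by
  have e : embed L μ κ = ((StateSpace.inlL L μ κ).comp (volterra L)).comp
      ((WithLp.sndL 2 ℝ (StateSpace L μ κ) (L2 L)).comp (formSpace L μ κ).subtypeL)
      + (constState L μ κ).comp ((StateSpace.odeL L μ κ).comp (embed L μ κ)) := by
    refine ContinuousLinearMap.ext fun v => StateSpace.ext ?_ ?_
    · refine (mem_formSpace_iff_eq.1 v.2).trans ?_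
      rw [add_comm]
      refine congrArg₂ _ rfl ?_
      change _ = v.1.fst.ode • Lp.const 2 (volume.restrict (Ioo 0 L)) μ
      rw [mul_comm, ← smul_eq_mul]
      exact (Lp.constL 2 (volume.restrict (Ioo 0 L)) ℝ).map_smul v.1.fst.ode μ
    · change v.1.fst.ode = 0 + v.1.fst.ode * 1
      ring
  have h1 : IsCompactOperator (((StateSpace.inlL L μ κ).comp (volterra L)).comp
      ((WithLp.sndL 2 ℝ (StateSpace L μ κ) (L2 L)).comp (formSpace L μ κ).subtypeL)) :=
    (isCompactOperator_volterra.clm_comp (StateSpace.inlL L μ κ)).comp_clm _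
  have h2 : IsCompactOperator
      ((constState L μ κ).comp ((StateSpace.odeL L μ κ).comp (embed L μ κ))) :=
    (isCompactOperator_of_locallyCompactSpace_rng (constState L μ κ)).comp_clm _
  rw [e]
  exact h1.add h2

/-- Supplies the elements used for testing: `(φ, 0)` with `φ` a test function, `(μ, 1)` and `(x,
0)`. -/
lemma exists_formSpace_of_contDiff {u : ℝ → ℝ} (hu : ContDiff ℝ 1 u) {β : ℝ} (hβ : u 0 = μ * β) :
    ∃ v : formSpace L μ κ, v.1.fst.heat =ᵐ[volume.restrict (Ioo 0 L)] u ∧ v.1.fst.ode = β ∧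
      v.1.snd =ᵐ[volume.restrict (Ioo 0 L)] deriv u ∧ ∀ x ∈ Icc 0 L, prim (u 0) v.1.snd x = u x := by
  have hm := memLp_of_continuousOn (L := L) hu.continuous.continuousOn
  have hm' := memLp_of_continuousOn (L := L) (hu.continuous_deriv le_rfl).continuousOn
  have hprim : ∀ x ∈ Icc 0 L, prim (u 0) (hm'.toLp _) x = u x := by
    intro x hx
    have e : ∫ t in (0 : ℝ)..x, hm'.toLp _ t = ∫ t in (0 : ℝ)..x, deriv u t := by
      refine intervalIntegral.integral_congr_ae_restrict ?_
      rw [uIoc_of_le hx.1, ← restrict_Ioo_eq_restrict_Ioc]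
      exact ae_restrict_of_ae_restrict_of_subset (Ioo_subset_Ioo_right hx.2) hm'.coeFn_toLp
    rw [prim, e, intervalIntegral.integral_deriv_eq_sub
      (fun t _ => (hu.differentiable one_ne_zero) t)
      ((hu.continuous_deriv le_rfl).intervalIntegrable _ _)]
    ring
  refine ⟨⟨WithLp.toLp 2 (StateSpace.mk (hm.toLp u) β, hm'.toLp _), mem_formSpace_iff.2 ?_⟩,
    hm.coeFn_toLp, rfl, hm'.coeFn_toLp, hprim⟩
  change hm.toLp u =ᵐ[volume.restrict (Ioo 0 L)] prim (μ * β) (hm'.toLp _)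
  filter_upwards [hm.coeFn_toLp, ae_restrict_mem measurableSet_Ioo] with x hx hx'
  rw [hx, ← hβ, hprim x (Ioo_subset_Icc_self hx')]

lemma exists_formSpace_test {φ : ℝ → ℝ} (h1 : ContDiff ℝ (⊤ : ℕ∞) φ) (h3 : tsupport φ ⊆ Ioo 0 L) :
    ∃ v : formSpace L μ κ, v.1.fst.heat =ᵐ[volume.restrict (Ioo 0 L)] φ ∧ v.1.fst.ode = 0 ∧
      v.1.snd =ᵐ[volume.restrict (Ioo 0 L)] deriv φ := by
  have h0 : φ 0 = 0 := by
    by_contra hne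
    exact lt_irrefl _ (h3 (subset_tsupport _ hne)).1
  obtain ⟨v, hv1, hv2, hv3, -⟩ := exists_formSpace_of_contDiff (μ := μ) (κ := κ) (L := L)
    (h1.of_le (by simp)) (β := 0) (by rw [h0, mul_zero])
  exact ⟨v, hv1, hv2, hv3⟩

/-- `ℋ¹` is dense in `ℋ`. -/
lemma eq_zero_of_forall_inner_embed (F : StateSpace L μ κ)
    (hF : ∀ v, inner ℝ (embed L μ κ v) F = 0) : F = 0 := by
  have hμ : μ ≠ 0 := left_ne_zero_of_mul hμκ.out.ne'
  have hκ : κ ≠ 0 := right_ne_zero_of_mul hμκ.out.ne'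
  have hheat : F.heat = 0 := eq_zero_of_forall_integral_mul_test fun φ h1 h2 h3 => by
    obtain ⟨v, hv1, hv2, -⟩ := exists_formSpace_test (μ := μ) (κ := κ) h1 h3
    have h := hF v
    rw [StateSpace.inner_def, embed_apply, hv2, zero_mul, mul_zero, add_zero] at h
    refine Eq.trans (integral_congr_ae ?_) h
    filter_upwards [hv1] with x hx
    rw [hx, mul_comm]
  -- Once the first component is zero, the pair `(μ, 1)` detects the second, because `μ / κ ≠ 0`.
  obtain ⟨v, -, hv2, -⟩ := exists_formSpace_of_contDiff (μ := μ) (κ := κ) (L := L)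
    (u := fun _ => μ) contDiff_const (β := 1) (mul_one μ).symm
  have h := hF v
  rw [StateSpace.inner_def, hheat] at h
  simp_rw [mul_comm ((embed L μ κ v).heat _)] at h
  rw [integral_coeFn_zero_mul, embed_apply, hv2, zero_add, one_mul] at h
  refine StateSpace.ext hheat ?_
  exact (mul_eq_zero.1 h).resolve_left (div_ne_zero hμ hκ)

/-- Green's formula on `ℋ¹`. -/
lemma integral_prim_mul_snd (d : ℝ) (h : L2 L) (w : formSpace L μ κ) :
    ∫ x in Ioo 0 L, prim d h x * w.1.snd x = prim d h L * prim (μ * w.1.fst.ode) w.1.snd L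
      - d * (μ * w.1.fst.ode) - ∫ x in Ioo 0 L, h x * w.1.fst.heat x := by
  rw [integral_prim_mul hL.out d (μ * w.1.fst.ode)]
  congr 1
  refine integral_congr_ae ?_
  filter_upwards [mem_formSpace_iff.1 w.2] with x hx
  rw [hx]

lemma inner_snd_eq {v : formSpace L μ κ} {d : ℝ} {h : L2 L}
    (hv : v.1.snd =ᵐ[volume.restrict (Ioo 0 L)] prim d h) (w : formSpace L μ κ) :
    inner ℝ v.1.snd w.1.snd = prim d h L * prim (μ * w.1.fst.ode) w.1.snd L
      - d * (μ * w.1.fst.ode) - ∫ x in Ioo 0 L, h x * w.1.fst.heat x := by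
  rw [inner_eq_integral, ← integral_prim_mul_snd]
  refine integral_congr_ae ?_
  filter_upwards [hv] with x hx
  rw [hx]

/-- Pairing with `w` in the form space turns the left side into `⟨v, w⟩_ℋ + ⟨v', w'⟩ = ⟨v - W,
w⟩_ℋ`; the common term cancels, leaving the weak form of `𝒜 v = W`. -/
lemma eq_adjoint_embed_iff (v : formSpace L μ κ) (W : StateSpace L μ κ) :
    v = embedAdjoint L μ κ (v.1.fst - W) ↔
      ∀ w : formSpace L μ κ, inner ℝ v.1.snd w.1.snd = - inner ℝ W w.1.fst := by
  have key : ∀ w : formSpace L μ κ, inner ℝ v w = inner ℝ (embedAdjoint L μ κ (v.1.fst - W)) w ↔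
      inner ℝ v.1.snd w.1.snd = - inner ℝ W w.1.fst := fun w => by
    rw [ContinuousLinearMap.adjoint_inner_left, inner_formSpace, embed_apply, inner_sub_left]
    constructor <;> intro h <;> linarith
  simp_rw [← key]
  exact ⟨fun h w => by rw [← h], fun h => ext_inner_right ℝ h⟩

/-- `(1 - 𝒜)⁻¹` is the operator associated with the inner product of `ℋ¹`. -/
lemma mem_graph_opA_iff (U W : StateSpace L μ κ) : (U, W) ∈ (opA L μ κ).graph ↔
    U = embed L μ κ (embedAdjoint L μ κ (U - W)) := by
  have hμ : μ ≠ 0 := left_ne_zero_of_mul hμκ.out.ne'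
  have hκ : κ ≠ 0 := right_ne_zero_of_mul hμκ.out.ne'
  have h0 : (0 : ℝ) ∈ Icc 0 L := left_mem_Icc.2 hL.out.le
  have hLL : L ∈ Icc 0 L := right_mem_Icc.2 hL.out.le
  constructor
  · intro hUW
    obtain ⟨⟨U, hU⟩, rfl, rfl⟩ := (LinearPMap.mem_graph_iff _).1 hUW
    have hg := (isWeakDeriv_weakDeriv hU.1.1.1).ae_eq_prim hU.1.2
    have hh := (isWeakDeriv_weakDeriv hU.1.1.2).ae_eq_prim (hasBoundaryValue_deriv_zero hU)
    have hend := hU.2.unique hL.out hLL (hasBoundaryValue_of_ae_eq_prim hL.out hh L)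
    let v : formSpace L μ κ := ⟨WithLp.toLp 2 (U, weakDeriv U.heat), mem_formSpace_iff.2 hg⟩
    have hv := (eq_adjoint_embed_iff v (opA L μ κ ⟨U, hU⟩)).2 fun w => by
      -- The term at `L` vanishes since `y'(L) = 0`; the term at `0` matches the second component
      -- because the weight `μ / κ` turns `κ y'(0)` into `μ y'(0)`.
      rw [inner_snd_eq hh, ← hend, StateSpace.inner_def]
      change _ = -((∫ x in Ioo 0 L, weakDeriv (weakDeriv U.heat) x * _)
        + μ / κ * (κ * boundaryValue (weakDeriv U.heat) 0 * _))
      field_simp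
      ring
    exact congrArg (embed L μ κ) hv
  · intro hU
    set v := embedAdjoint L μ κ (U - W) with hv
    have hvU : v.1.fst = U := hU.symm
    have hvw := (eq_adjoint_embed_iff v W).1 (by rw [hvU])
    -- Testing with `(φ, 0)`, `φ` compactly supported in `(0, L)`, gives `y'' = W.heat` without
    -- boundary terms.
    have hweak : IsWeakDeriv v.1.snd W.heat := fun φ h1 h2 h3 => by
      obtain ⟨w, hw1, hw2, hw3⟩ := exists_formSpace_test (μ := μ) (κ := κ) h1 h3
      have h := hvw w
      rw [inner_eq_integral, StateSpace.inner_def, hw2, mul_zero, mul_zero, add_zero] at h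
      convert h using 1
      · refine integral_congr_ae ?_
        filter_upwards [hw3] with x hx
        rw [hx]
      · rw [neg_inj]
        refine integral_congr_ae ?_
        filter_upwards [hw1] with x hx
        rw [hx]
    obtain ⟨d, hd⟩ := hweak.exists_ae_eq_prim
    -- With the interior terms cancelled, only the boundary terms remain; here `d = y'(0)` and `prim
    -- d W.heat L = y'(L)`. The pair `(x, 0)` isolates the condition at `L`, then `(μ, 1)` the one
    -- at `0`.
    have hgreen : ∀ w : formSpace L μ κ, prim d W.heat L * prim (μ * w.1.fst.ode) w.1.snd L
        = (d * μ - μ / κ * W.ode) * w.1.fst.ode := fun w => by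
      have h := hvw w
      rw [inner_snd_eq hd, StateSpace.inner_def] at h
      linarith
    have hend : prim d W.heat L = 0 := by
      obtain ⟨w, -, hw2, -, hw4⟩ := exists_formSpace_of_contDiff (μ := μ) (κ := κ) (L := L)
        (u := fun x => x) contDiff_id (β := 0) (mul_zero μ).symm
      have h := hgreen w
      rw [hw2, mul_zero, hw4 L hLL, mul_zero] at h
      exact (mul_eq_zero.1 h).resolve_right hL.out.ne'
    have hode : κ * d = W.ode := by
      obtain ⟨w, -, hw2, -, -⟩ := exists_formSpace_of_contDiff (μ := μ) (κ := κ) (L := L)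
        (u := fun _ => μ) contDiff_const (β := 1) (mul_one μ).symm
      have h := hgreen w
      rw [hend, zero_mul, hw2, mul_one] at h
      field_simp at h
      rw [zero_mul, eq_comm, mul_eq_zero, sub_eq_zero] at h
      rw [mul_comm]
      exact h.resolve_left hμ
    have hwd : weakDeriv U.heat = v.1.snd := by
      rw [← hvU]
      exact (isWeakDeriv_snd v).weakDeriv_eq
    have hbv := hasBoundaryValue_of_ae_eq_prim hL.out (mem_formSpace_iff.1 v.2) 0
    rw [prim_zero, hvU] at hbv
    have hdom : U ∈ domainA L μ κ := by
      refine ⟨⟨⟨⟨v.1.snd, ?_⟩, ?_⟩, hbv⟩, ?_⟩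
      · rw [← hvU]
        exact isWeakDeriv_snd v
      · rw [hwd]
        exact ⟨_, hweak⟩
      · have hb := hasBoundaryValue_of_ae_eq_prim hL.out hd L
        rwa [hend, ← hwd] at hb
    refine (LinearPMap.mem_graph_iff _).2 ⟨⟨U, hdom⟩, rfl, StateSpace.ext ?_ ?_⟩
    · change weakDeriv (weakDeriv U.heat) = W.heat
      rw [hwd, hweak.weakDeriv_eq]
    · change κ * boundaryValue (weakDeriv U.heat) 0 = W.ode
      have hb := hasBoundaryValue_of_ae_eq_prim hL.out hd 0
      rw [prim_zero] at hb
      rw [hwd, hb.boundaryValue_eq hL.out h0, hode]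

lemma mem_spaceH1_iff (U : StateSpace L μ κ) : U ∈ SpaceH1 L μ κ ↔ ∃ v, embed L μ κ v = U := by
  constructor
  · intro hU
    exact ⟨⟨WithLp.toLp 2 (U, weakDeriv U.heat),
      mem_formSpace_iff.2 ((isWeakDeriv_weakDeriv hU.1).ae_eq_prim hU.2)⟩, rfl⟩
  · rintro ⟨v, rfl⟩
    have h := hasBoundaryValue_of_ae_eq_prim hL.out (mem_formSpace_iff.1 v.2) 0
    rw [prim_zero] at h
    exact ⟨⟨_, isWeakDeriv_snd v⟩, h⟩

lemma normH1_embed (v : formSpace L μ κ) : normH1 (embed L μ κ v) = ‖v‖ := by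
  have e : weakDeriv (embed L μ κ v).heat = v.1.snd := (isWeakDeriv_snd v).weakDeriv_eq
  rw [normH1, ← Real.sqrt_sq (norm_nonneg v), norm_sq_formSpace, e, ← norm_sq_eq_integral v.1.snd,
    ← real_inner_self_eq_norm_sq v.1.fst, StateSpace.inner_def, embed_apply]
  simp_rw [sq]
  congr 1
  ring

end HeatODE

end

theorem proposition2p1 (L μ κ : ℝ) [Fact (0 < L)] [Fact (0 < μ * κ)] :
    Dense ((HeatODE.opA L μ κ).domain : Set (HeatODE.StateSpace L μ κ)) ∧
    IsSelfAdjoint (HeatODE.opA L μ κ) ∧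
    HeatODE.GeneratesAnalyticC0Semigroup (HeatODE.opA L μ κ) ∧
    -- the interpolation identity, as an equality of sets with equivalent norms
    HeatODE.interpSpace (HeatODE.opA L μ κ).domain (HeatODE.graphNorm (HeatODE.opA L μ κ)) (1 / 2) 2
      = (HeatODE.SpaceH1 L μ κ : Set (HeatODE.StateSpace L μ κ)) ∧
    ∃ c C : ℝ, 0 < c ∧ 0 < C ∧ ∀ U ∈ HeatODE.SpaceH1 L μ κ,
      ENNReal.ofReal (c * HeatODE.normH1 U) ≤
        HeatODE.interpNorm (HeatODE.opA L μ κ).domain (HeatODE.graphNorm (HeatODE.opA L μ κ))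
          (1 / 2) 2 U ∧
      HeatODE.interpNorm (HeatODE.opA L μ κ).domain (HeatODE.graphNorm (HeatODE.opA L μ κ))
          (1 / 2) 2 U ≤ ENNReal.ofReal (C * HeatODE.normH1 U) := by
  -- The heat equation enters through the five hypotheses on the embedding and through the
  -- identification of its range and norm with `ℋ¹`; the rest holds for any nonpositive diagonal
  -- operator.
  have hdiag := HeatODE.exists_isDiagonal (H := HeatODE.StateSpace L μ κ)
    (V := HeatODE.formSpace L μ κ) (J := HeatODE.embed L μ κ) (A := HeatODE.opA L μ κ)
    ?_ ?_ ?_ ?_ ?_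
  rotate_left
  · exact HeatODE.isCompactOperator_embed
  · exact HeatODE.injective_embed
  · intro F hF
    apply HeatODE.eq_zero_of_forall_inner_embed F
    intro v
    exact hF v
  · intro v
    exact HeatODE.norm_embed_le v
  · intro U W
    exact HeatODE.mem_graph_opA_iff U W
  obtain ⟨ι, b, s, hs, hA, hsum, hex⟩ := hdiag
  refine ⟨hA.dense_domain, hA.isSelfAdjoint, hA.generatesAnalyticC0Semigroup hs, ?_,
    √(Real.pi / 4), √(3 * Real.pi / 2), by positivity, by positivity, fun U hU => ?_⟩
  · ext U
    rw [hA.mem_interpSpace_iff hs, SetLike.mem_coe, HeatODE.mem_spaceH1_iff]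
    exact ⟨hex U, fun ⟨v, hv⟩ => hv ▸ (hsum v).summable⟩
  · obtain ⟨v, rfl⟩ := (HeatODE.mem_spaceH1_iff U).1 hU
    rw [HeatODE.normH1_embed]
    exact hA.interpNorm_equiv hs (norm_nonneg v) (hsum v)
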